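/- A set $F$ of vertices of a simplicial complex $\Delta$ is a \emph{missing $i$-face} of $\Delta$ if $|F|=i+1$, $F$ is not a face of $\Delta$, and every proper subset of $F$ is a face of $\Delta$; let $m_i(\Delta)$ denote the number of missing $i$-faces of $\Delta$. A \emph{PL $4$-sphere} is a finite simplicial complex whose geometric realization is piecewise linearly homeomorphic to the boundary of the $5$-dimensional simplex. It is \emph{$2$-neighborly} if every two of its vertices form an edge, that is, if $f_1=\binom{f_0}{2}$, where $f_i$ denotes the number of $i$-dimensional faces. \textbf{Theorem.} For every integer $n\ge 9$ and every integer $m$ with $0\le m\le \binom{n-5}{2}$ and $m\ne \binom{n-5}{2}-1$, there exists a $2$-neighborly PL $4$-sphere $\Delta$ with exactly $n$ vertices and $m_3(\Delta)=m$. -/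

import Mathlib

/-- A convex polyhedron: an intersection of finitely many closed half-spaces. -/
def IsConvexPolyhedron {E : Type*} [AddCommGroup E] [Module ℝ E] (P : Set E) : Prop :=
  ∃ H : Finset (E →ᵃ[ℝ] ℝ), P = {x | ∀ h ∈ H, 0 ≤ h x}

/-- A map `f : s → t` is piecewise linear if `s` is a union of finitely many convex polyhedra,
on each of which `f` is the restriction of an affine map. (When `s` is bounded, as it is for the
geometric realization of a finite simplicial complex, these polyhedra are polytopes.) -/
def IsPiecewiseLinear {E F : Type*} [AddCommGroup E] [Module ℝ E] [AddCommGroup F] [Module ℝ F]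
    {s : Set E} {t : Set F} (f : s → t) : Prop :=
  ∃ 𝒞 : Set (Set E), 𝒞.Finite ∧ ⋃₀ 𝒞 = s ∧
    ∀ P ∈ 𝒞, IsConvexPolyhedron P ∧ ∃ A : E →ᵃ[ℝ] F, ∀ x : s, (x : E) ∈ P → (f x : F) = A x

/-- Piecewise linear homeomorphism of two sets. -/
def PLHomeomorphic {E F : Type*} [AddCommGroup E] [Module ℝ E] [TopologicalSpace E]
    [AddCommGroup F] [Module ℝ F] [TopologicalSpace F] (s : Set E) (t : Set F) : Prop :=
  ∃ e : s ≃ₜ t, IsPiecewiseLinear e ∧ IsPiecewiseLinear e.symm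

namespace AbstractSimplicialComplex

/-- Mathlib lists only the nonempty faces of a complex; here the empty set counts as a face. -/
def IsFace {V : Type*} (Δ : AbstractSimplicialComplex V) (F : Finset V) : Prop :=
  F = ∅ ∨ F ∈ Δ.faces

/-- A missing face: not a face, although all its proper subsets are faces. -/
def IsMissingFace {V : Type*} (Δ : AbstractSimplicialComplex V) (F : Finset V) : Prop :=
  ¬ Δ.IsFace F ∧ ∀ G : Finset V, G ⊂ F → Δ.IsFace G

/-- The number `f_{k-1}` of faces of size `k`, that is, of dimension `k - 1`. -/
noncomputable def faceCount {V : Type*} (Δ : AbstractSimplicialComplex V) (k : ℕ) : ℕ :=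
  Set.ncard {F : Finset V | Δ.IsFace F ∧ F.card = k}

/-- The number `m_i` of missing `i`-faces, that is, of missing faces of size `i + 1`. -/
noncomputable def missingFaceCount {V : Type*} (Δ : AbstractSimplicialComplex V) (i : ℕ) : ℕ :=
  Set.ncard {F : Finset V | Δ.IsMissingFace F ∧ F.card = i + 1}

/-- `Δ` is `k`-neighborly if `f_{k-1} = (f_0 choose k)`. -/
def IsNeighborly {V : Type*} (Δ : AbstractSimplicialComplex V) (k : ℕ) : Prop :=
  Δ.faceCount k = (Δ.faceCount 1).choose k

/-- The geometric realization of a complex on a finite vertex set `V`, in `V → ℝ`: the points of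
the standard simplex (barycentric coordinates) whose support is a face. -/
def realization {V : Type*} [Fintype V] (Δ : AbstractSimplicialComplex V) : Set (V → ℝ) :=
  {x | x ∈ stdSimplex ℝ V ∧ ∃ F ∈ Δ.faces, ∀ v : V, v ∈ F ↔ x v ≠ 0}

/-- The boundary complex of the `(d + 1)`-dimensional simplex: all nonempty proper subsets of a
set of `d + 2` vertices. -/
def simplexBoundary (d : ℕ) : AbstractSimplicialComplex (Fin (d + 2)) where
  faces := {F | F.Nonempty ∧ F ≠ Finset.univ}
  isRelLowerSet_faces := by
    intro F hF
    refine ⟨hF.1, fun G hGF hG => ⟨hG, ?_⟩⟩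
    rintro rfl
    exact hF.2 (Finset.univ_subset_iff.mp hGF)
  singleton_mem := by
    intro v
    refine ⟨Finset.singleton_nonempty v, fun h => ?_⟩
    have hc := congrArg Finset.card h
    simp at hc

/-- A PL `d`-sphere: the geometric realization is piecewise linearly homeomorphic to the boundary
of a `(d + 1)`-dimensional simplex. -/
def IsPLSphere {V : Type*} [Fintype V] (Δ : AbstractSimplicialComplex V) (d : ℕ) : Prop :=
  PLHomeomorphic Δ.realization (simplexBoundary d).realization

end AbstractSimplicialComplex

/-!
Coning over the boundary of a shellable ball inside a sphere replaces the ball by the cone. Since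
this is a sequence of bistellar flips, the result is again a PL sphere, and the missing faces that
are created are exactly the minimal interior faces of the ball which are small enough.

The balls used here are cones, with apex a vertex `w` of the current sphere, over three-dimensional
balls `B` in the join of two lines, both subdivided at the integers. A facet of this join is a cell
of the square grid, so that `B` is a region in the grid, here a staircase. The new apex replaces
`w` as a vertex of the next ball, which is obtained by adding a row or a column of cells. A step
adds as many missing tetrahedra as there are interior triangles of `B` without interior edges, and
this number is controlled by the shape of the staircase. Rectangles with a single column give the
maximal number of missing tetrahedra; a second column on the right with a suitable height, followed
by a column on the left, gives the numbers between consecutive maxima, and further columns on the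
left create no missing tetrahedra at all. The case `m = 0` needs a starting sphere of its own, with
nine vertices.
-/

open Set

section PiecewiseLinear

variable {E F G : Type*} [AddCommGroup E] [Module ℝ E] [AddCommGroup F] [Module ℝ F]
  [AddCommGroup G] [Module ℝ G]

theorem IsConvexPolyhedron.inter {P Q : Set E} (hP : IsConvexPolyhedron P)
    (hQ : IsConvexPolyhedron Q) : IsConvexPolyhedron (P ∩ Q) := by
  classical
  obtain ⟨H, rfl⟩ := hP
  obtain ⟨H', rfl⟩ := hQ
  refine ⟨H ∪ H', ?_⟩
  ext x
  simp [or_imp, forall_and]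

theorem IsConvexPolyhedron.preimage {Q : Set F} (hQ : IsConvexPolyhedron Q) (A : E →ᵃ[ℝ] F) :
    IsConvexPolyhedron (A ⁻¹' Q) := by
  classical
  obtain ⟨H, rfl⟩ := hQ
  refine ⟨H.image fun h => h.comp A, ?_⟩
  ext x
  simp

theorem isConvexPolyhedron_setOf_forall {ι : Type*} [Finite ι] (h : ι → E →ₗ[ℝ] ℝ) :
    IsConvexPolyhedron {x | ∀ i, 0 ≤ h i x} := by
  classical
  have := Fintype.ofFinite ι
  refine ⟨Finset.univ.image fun i => (h i).toAffineMap, ?_⟩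
  ext x
  simp

theorem isConvexPolyhedron_setOf_eq (h : E →ₗ[ℝ] ℝ) (c : ℝ) :
    IsConvexPolyhedron {x | h x = c} := by
  classical
  refine ⟨{h.toAffineMap - AffineMap.const ℝ E c, AffineMap.const ℝ E c - h.toAffineMap}, ?_⟩
  ext x
  simp [le_antisymm_iff, and_comm]

/-- A polyhedron, not necessarily convex: a finite union of convex polyhedra. These are the
domains on which affine maps restrict to piecewise linear maps. -/
def IsPolyhedron (s : Set E) : Prop :=
  ∃ 𝒞 : Set (Set E), 𝒞.Finite ∧ ⋃₀ 𝒞 = s ∧ ∀ P ∈ 𝒞, IsConvexPolyhedron P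

theorem IsPolyhedron.isPiecewiseLinear {s : Set E} (hs : IsPolyhedron s) {t : Set F} {f : s → t}
    (A : E →ᵃ[ℝ] F) (hf : ∀ x, (f x : F) = A x) : IsPiecewiseLinear f := by
  obtain ⟨𝒞, hfin, hunion, hconv⟩ := hs
  exact ⟨𝒞, hfin, hunion, fun P hP => ⟨hconv P hP, A, fun x _ => hf x⟩⟩

theorem IsPiecewiseLinear.comp {s : Set E} {t : Set F} {u : Set G} {g : t → u} {f : s → t}
    (hg : IsPiecewiseLinear g) (hf : IsPiecewiseLinear f) : IsPiecewiseLinear (g ∘ f) := by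
  obtain ⟨C, hC, hCs, hCf⟩ := hf
  obtain ⟨C', hC', hCs', hCg⟩ := hg
  choose! hconv A hA using hCf
  choose! hconv' A' hA' using hCg
  refine ⟨(fun q : Set E × Set F => q.1 ∩ A q.1 ⁻¹' q.2) '' (C ×ˢ C'),
    (hC.prod hC').image _, ?_, ?_⟩
  · ext x
    simp only [sUnion_image, mem_iUnion, mem_prod, Prod.exists, mem_inter_iff, mem_preimage,
      exists_prop]
    constructor
    · rintro ⟨P, Q, ⟨hP, -⟩, hx, -⟩
      exact hCs ▸ ⟨P, hP, hx⟩
    · intro hx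
      obtain ⟨P, hP, hxP⟩ : x ∈ ⋃₀ C := by rwa [hCs]
      obtain ⟨Q, hQ, hxQ⟩ : (f ⟨x, hx⟩ : F) ∈ ⋃₀ C' := by rw [hCs']; exact (f ⟨x, hx⟩).2
      exact ⟨P, Q, ⟨hP, hQ⟩, hxP, hA P hP ⟨x, hx⟩ hxP ▸ hxQ⟩
  · rintro _ ⟨⟨P, Q⟩, ⟨hP, hQ⟩, rfl⟩
    refine ⟨(hconv P hP).inter ((hconv' Q hQ).preimage _), (A' Q).comp (A P), ?_⟩
    rintro x ⟨hxP, hxQ⟩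
    have hfx : (f x : F) = A P x := hA P hP x hxP
    have hgfx := hA' Q hQ (f x) (by rw [hfx]; exact hxQ)
    simp [hgfx, hfx]

variable [TopologicalSpace E] [TopologicalSpace F] [TopologicalSpace G]

theorem PLHomeomorphic.trans {s : Set E} {t : Set F} {u : Set G} (h : PLHomeomorphic s t)
    (h' : PLHomeomorphic t u) : PLHomeomorphic s u := by
  obtain ⟨e, he, hsymm⟩ := h
  obtain ⟨e', he', hsymm'⟩ := h'
  exact ⟨e.trans e', he'.comp he, hsymm.comp hsymm'⟩

theorem IsPolyhedron.plHomeomorphic_image {s : Set E} (hs : IsPolyhedron s) (g : E →L[ℝ] F)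
    (f : F →L[ℝ] E) (hfg : Function.LeftInverse f g) (hgs : IsPolyhedron (g '' s)) :
    PLHomeomorphic (g '' s) s := by
  let e : g '' s ≃ₜ s :=
    { toFun y := ⟨f y, by obtain ⟨_, x, hx, rfl⟩ := y; rwa [hfg x]⟩
      invFun x := ⟨g x, mem_image_of_mem g x.2⟩
      left_inv := by rintro ⟨_, x, hx, rfl⟩; simp [hfg x]
      right_inv x := Subtype.ext (hfg x)
      continuous_toFun := by fun_prop
      continuous_invFun := by fun_prop }
  exact ⟨e, hgs.isPiecewiseLinear f.toLinearMap.toAffineMap fun _ => rfl,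
    hs.isPiecewiseLinear g.toLinearMap.toAffineMap fun _ => rfl⟩

end PiecewiseLinear

section Realization

variable {W U : Type*} [Fintype U]

/-- Extension by zero `(U → ℝ) → (W → ℝ)` along an embedding of the vertex set `U` into `W`. -/
noncomputable def extendByZero (e : U ↪ W) : (U → ℝ) →L[ℝ] (W → ℝ) :=
  LinearMap.toContinuousLinearMap (Function.ExtendByZero.linearMap ℝ e)

theorem extendByZero_apply (e : U ↪ W) (x : U → ℝ) (u : U) : extendByZero e x (e u) = x u :=
  e.injective.extend_apply _ _ _

theorem extendByZero_apply_of_notMem_range (e : U ↪ W) (x : U → ℝ) {w : W} (hw : w ∉ range e) :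
    extendByZero e x w = 0 :=
  Function.extend_apply' _ _ _ hw

variable [Fintype W] {K : Set (Finset W)}

/-- The geometric realization of a family `K` of finite sets: the points of the standard simplex
whose support belongs to `K`. Families are more convenient than complexes here because they need
not cover the vertex set. -/
def geometricRealization (K : Set (Finset W)) : Set (W → ℝ) :=
  {x | x ∈ stdSimplex ℝ W ∧ ∃ F ∈ K, ∀ v : W, v ∈ F ↔ x v ≠ 0}

/-- The closed face of the standard simplex spanned by `F`. -/
def closedFace (F : Finset W) : Set (W → ℝ) :=
  {x | x ∈ stdSimplex ℝ W ∧ ∀ v ∉ F, x v = 0}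

theorem isConvexPolyhedron_closedFace (F : Finset W) : IsConvexPolyhedron (closedFace F) := by
  have hnonneg := isConvexPolyhedron_setOf_forall
    (fun v : W => (LinearMap.proj v : (W → ℝ) →ₗ[ℝ] ℝ))
  have hnonpos := isConvexPolyhedron_setOf_forall
    (fun v : {v : W // v ∉ F} => (-LinearMap.proj v.1 : (W → ℝ) →ₗ[ℝ] ℝ))
  have hsum := isConvexPolyhedron_setOf_eq (∑ v : W, LinearMap.proj v : (W → ℝ) →ₗ[ℝ] ℝ) 1
  suffices h : closedFace F = _ from h ▸ (hnonneg.inter hnonpos).inter hsum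
  ext x
  simp only [closedFace, stdSimplex, mem_ofPred_eq, mem_inter_iff, LinearMap.proj_apply,
    LinearMap.neg_apply, LinearMap.sum_apply, Subtype.forall]
  constructor
  · rintro ⟨⟨hx, hone⟩, hzero⟩
    exact ⟨⟨hx, fun v hv => by simp [hzero v hv]⟩, hone⟩
  · rintro ⟨⟨hx, hzero⟩, hone⟩
    exact ⟨⟨hx, hone⟩, fun v hv => le_antisymm (by linarith [hzero v hv]) (hx v)⟩

theorem sUnion_closedFace (hK : IsLowerSet K) :
    ⋃₀ (closedFace '' K) = geometricRealization K := by
  classical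
  ext x
  simp only [sUnion_image, mem_iUnion, exists_prop]
  constructor
  · rintro ⟨F, hF, hx, hzero⟩
    refine ⟨hx, Finset.univ.filter fun v => x v ≠ 0, hK (fun v hv => ?_) hF, by simp⟩
    by_contra hvF
    simp [hzero v hvF] at hv
  · rintro ⟨hx, F, hF, hsupp⟩
    exact ⟨F, hF, hx, fun v hv => not_not.1 (mt (hsupp v).2 hv)⟩

theorem isPolyhedron_geometricRealization (hK : IsLowerSet K) :
    IsPolyhedron (geometricRealization K) :=
  ⟨closedFace '' K, toFinite _, sUnion_closedFace hK,
    forall_mem_image.2 fun F _ => isConvexPolyhedron_closedFace F⟩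

theorem geometricRealization_setOf_nonempty :
    geometricRealization {F | F.Nonempty ∧ F ∈ K} = geometricRealization K := by
  ext x
  refine and_congr_right fun hx => exists_congr fun F => ?_
  refine and_congr_left fun hsupp => and_iff_right_iff_imp.2 fun _ => ?_
  by_contra hF
  have hzero : ∀ v, x v = 0 := by simpa [Finset.not_nonempty_iff_eq_empty.1 hF] using hsupp
  simpa [hzero] using hx.2

theorem extendByZero_mem_stdSimplex_iff (e : U ↪ W) {x : U → ℝ} :
    extendByZero e x ∈ stdSimplex ℝ W ↔ x ∈ stdSimplex ℝ U := by
  have hsum : ∑ u, x u = ∑ w, extendByZero e x w :=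
    Fintype.sum_of_injective e e.injective _ _
      (fun w hw => extendByZero_apply_of_notMem_range e x hw)
      (fun u => (extendByZero_apply e x u).symm)
  refine and_congr ⟨fun h u => extendByZero_apply e x u ▸ h (e u), fun h w => ?_⟩ (by rw [hsum])
  by_cases hw : w ∈ range e
  · obtain ⟨u, rfl⟩ := hw
    exact (extendByZero_apply e x u).symm ▸ h u
  · exact (extendByZero_apply_of_notMem_range e x hw).ge

theorem geometricRealization_image_map (e : U ↪ W) (L : Set (Finset U)) :
    geometricRealization (Finset.map e '' L) = extendByZero e '' geometricRealization L := by
  ext y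
  constructor
  · rintro ⟨hy, _, ⟨F, hF, rfl⟩, hsupp⟩
    have hext : extendByZero e (y ∘ e) = y := by
      ext w
      by_cases hw : w ∈ range e
      · obtain ⟨u, rfl⟩ := hw
        exact extendByZero_apply e _ u
      · rw [extendByZero_apply_of_notMem_range e _ hw]
        by_contra h
        obtain ⟨u, -, hu⟩ := Finset.mem_map.1 ((hsupp w).2 (Ne.symm h))
        exact hw ⟨u, hu⟩
    refine ⟨y ∘ e, ⟨(extendByZero_mem_stdSimplex_iff e).1 (hext.symm ▸ hy), F, hF, fun u => ?_⟩,
      hext⟩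
    rw [← Finset.mem_map' e, hsupp, Function.comp_apply]
  · rintro ⟨x, ⟨hx, F, hF, hsupp⟩, rfl⟩
    refine ⟨(extendByZero_mem_stdSimplex_iff e).2 hx, F.map e, ⟨F, hF, rfl⟩, fun w => ?_⟩
    by_cases hw : w ∈ range e
    · obtain ⟨u, rfl⟩ := hw
      rw [Finset.mem_map' e, hsupp, extendByZero_apply]
    · rw [extendByZero_apply_of_notMem_range e x hw]
      simpa using fun u _ h => hw ⟨u, h⟩

theorem plHomeomorphic_geometricRealization_image_map (e : U ↪ W) {L : Set (Finset U)}
    (hL : IsLowerSet L) (hmap : IsLowerSet (Finset.map e '' L)) :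
    PLHomeomorphic (geometricRealization (Finset.map e '' L)) (geometricRealization L) := by
  have hpoly := isPolyhedron_geometricRealization hmap
  rw [geometricRealization_image_map] at hpoly ⊢
  exact (isPolyhedron_geometricRealization hL).plHomeomorphic_image _
    (LinearMap.toContinuousLinearMap (LinearMap.funLeft ℝ ℝ e))
    (fun x => funext (extendByZero_apply e x)) hpoly

end Realization

section Flip

variable {V : Type*} [DecidableEq V] {K : Set (Finset V)} {σ τ : Finset V}

/-- The bistellar flip of the family `K` that replaces `σ * ∂τ` by `∂σ * τ`. -/
def bistellarFlip (K : Set (Finset V)) (σ τ : Finset V) : Set (Finset V) :=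
  (K ∪ Icc τ (σ ∪ τ)) \ Ici σ

/-- The bistellar flip replacing `σ * ∂τ` by `∂σ * τ` is allowed in `K`: the star of `σ` is
`σ * ∂τ` (conditions `star` and `mem`) and `τ` is not yet a face. -/
structure IsFlippable (K : Set (Finset V)) (σ τ : Finset V) : Prop where
  lower : IsLowerSet K
  disjoint : Disjoint σ τ
  left_nonempty : σ.Nonempty
  right_nonempty : τ.Nonempty
  star : ∀ F ∈ K, σ ⊆ F → F ⊆ σ ∪ τ
  mem : ∀ F ⊆ σ ∪ τ, ¬ τ ⊆ F → F ∈ K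
  notMem : τ ∉ K

theorem mem_bistellarFlip {F : Finset V} :
    F ∈ bistellarFlip K σ τ ↔ (F ∈ K ∨ τ ⊆ F ∧ F ⊆ σ ∪ τ) ∧ ¬ σ ⊆ F :=
  Iff.rfl

theorem IsFlippable.isLowerSet_flip (h : IsFlippable K σ τ) :
    IsLowerSet (bistellarFlip K σ τ) := by
  rintro F G (hGF : G ⊆ F) hF
  rw [mem_bistellarFlip] at hF ⊢
  refine ⟨hF.1.elim (fun hFK => .inl (h.lower hGF hFK)) fun hτF => ?_,
    fun hσ => hF.2 (hσ.trans hGF)⟩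
  by_cases hτG : τ ⊆ G
  · exact .inr ⟨hτG, hGF.trans hτF.2⟩
  · exact .inl (h.mem G (hGF.trans hτF.2) hτG)

theorem IsFlippable.symm (h : IsFlippable K σ τ) : IsFlippable (bistellarFlip K σ τ) τ σ where
  lower := h.isLowerSet_flip
  disjoint := h.disjoint.symm
  left_nonempty := h.right_nonempty
  right_nonempty := h.left_nonempty
  star F hF hτF := by
    rw [Finset.union_comm]
    exact hF.1.elim (fun hFK => absurd (h.lower hτF hFK) h.notMem) And.right
  mem F hF hσF := by
    rw [Finset.union_comm] at hF
    by_cases hτF : τ ⊆ F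
    · exact ⟨.inr ⟨hτF, hF⟩, hσF⟩
    · exact ⟨.inl (h.mem F hF hτF), hσF⟩
  notMem hσ := hσ.2 self_mem_Ici

theorem IsFlippable.flip_flip (h : IsFlippable K σ τ) :
    bistellarFlip (bistellarFlip K σ τ) τ σ = K := by
  ext F
  simp only [mem_bistellarFlip, Finset.union_comm τ σ]
  constructor
  · rintro ⟨⟨hFK | hτF, -⟩ | ⟨-, hF⟩, hnot⟩
    exacts [hFK, absurd hτF.1 hnot, h.mem F hF hnot]
  · intro hF
    have hτF : ¬ τ ⊆ F := fun hτF => h.notMem (h.lower hτF hF)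
    by_cases hσF : σ ⊆ F
    · exact ⟨.inr ⟨hσF, h.star F hF hσF⟩, hτF⟩
    · exact ⟨.inl ⟨.inl hF, hσF⟩, hτF⟩

end Flip

section FlipMap

variable {W : Type*} {σ τ : Finset W} {x : W → ℝ}

/-- The barycenter of the face `σ` of the standard simplex. -/
noncomputable def barycenter (σ : Finset W) : W → ℝ :=
  indicator σ fun _ => (σ.card : ℝ)⁻¹

theorem barycenter_apply_of_mem {v : W} (hv : v ∈ σ) : barycenter σ v = (σ.card : ℝ)⁻¹ :=
  indicator_of_mem hv _

theorem barycenter_apply_of_notMem {v : W} (hv : v ∉ σ) : barycenter σ v = 0 :=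
  indicator_of_notMem hv _

theorem sum_barycenter [Fintype W] (hσ : σ.Nonempty) : ∑ v, barycenter σ v = 1 := by
  classical
  have hcard : (σ.card : ℝ) ≠ 0 := by exact_mod_cast hσ.card_pos.ne'
  simp [barycenter, indicator_apply, hcard]

/-- The weight of the barycenter of `σ` in `x`: for `x` with nonnegative coordinates, the largest
`c` such that `x - c • barycenter σ` still has nonnegative coordinates. -/
noncomputable def barycenterWeight (hσ : σ.Nonempty) (x : W → ℝ) : ℝ :=
  σ.card * σ.inf' hσ x

theorem barycenterWeight_eq_of_forall_le (hσ : σ.Nonempty) {u : W} (hu : u ∈ σ)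
    (hmin : ∀ v ∈ σ, x u ≤ x v) : barycenterWeight hσ x = σ.card * x u := by
  rw [barycenterWeight, le_antisymm (Finset.inf'_le x hu) (Finset.le_inf' hσ x hmin)]

theorem exists_barycenterWeight_eq (hσ : σ.Nonempty) (x : W → ℝ) :
    ∃ u ∈ σ, (∀ v ∈ σ, x u ≤ x v) ∧ barycenterWeight hσ x = σ.card * x u := by
  obtain ⟨u, hu, hmin⟩ := σ.exists_min_image x hσ
  exact ⟨u, hu, hmin, barycenterWeight_eq_of_forall_le hσ hu hmin⟩

theorem barycenterWeight_eq_zero (hσ : σ.Nonempty) (hx : ∀ v, 0 ≤ x v) {F : Finset W}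
    (hF : ∀ v, v ∈ F ↔ x v ≠ 0) (hσF : ¬ σ ⊆ F) : barycenterWeight hσ x = 0 := by
  obtain ⟨u, hu, huF⟩ := Finset.not_subset.1 hσF
  have hzero : x u = 0 := not_not.1 (mt (hF u).2 huF)
  rw [barycenterWeight_eq_of_forall_le hσ hu fun v _ => hzero ▸ hx v, hzero, mul_zero]

theorem continuous_barycenterWeight (hσ : σ.Nonempty) :
    Continuous (barycenterWeight hσ : (W → ℝ) → ℝ) :=
  continuous_const.mul (Continuous.finset_inf'_apply hσ fun v _ => continuous_apply v)

/-- The map of realizations induced by a bistellar flip: the barycenter of `σ` is moved to the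
barycenter of `τ`, affinely on the cone from it over each boundary face. -/
noncomputable def flipMap (hσ : σ.Nonempty) (τ : Finset W) (x : W → ℝ) : W → ℝ :=
  x + barycenterWeight hσ x • (barycenter τ - barycenter σ)

theorem flipMap_apply (hσ : σ.Nonempty) (v : W) : flipMap hσ τ x v =
    x v + barycenterWeight hσ x * (barycenter τ v - barycenter σ v) :=
  rfl

theorem continuous_flipMap (hσ : σ.Nonempty) (τ : Finset W) : Continuous (flipMap hσ τ) :=
  continuous_id.add ((continuous_barycenterWeight hσ).smul continuous_const)

theorem barycenterWeight_flipMap (hσ : σ.Nonempty) (hτ : τ.Nonempty) (hdisj : Disjoint σ τ)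
    (hx : barycenterWeight hτ x = 0) :
    barycenterWeight hτ (flipMap hσ τ x) = barycenterWeight hσ x := by
  have hcard : (τ.card : ℝ) ≠ 0 := by exact_mod_cast hτ.card_pos.ne'
  have happly : ∀ v ∈ τ, flipMap hσ τ x v = x v + barycenterWeight hσ x * (τ.card : ℝ)⁻¹ :=
    fun v hv => by
      rw [flipMap_apply, barycenter_apply_of_mem hv,
        barycenter_apply_of_notMem (Finset.disjoint_right.1 hdisj hv), sub_zero]
  obtain ⟨u, hu, hmin, hweight⟩ := exists_barycenterWeight_eq hτ x
  have hzero : x u = 0 := by simpa [hx, hcard] using hweight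
  rw [barycenterWeight_eq_of_forall_le hτ hu fun v hv => by
    rw [happly u hu, happly v hv]; gcongr; exact hmin v hv, happly u hu, hzero]
  field_simp
  ring

theorem flipMap_flipMap (hσ : σ.Nonempty) (hτ : τ.Nonempty) (hdisj : Disjoint σ τ)
    (hx : barycenterWeight hτ x = 0) : flipMap hτ σ (flipMap hσ τ x) = x := by
  rw [flipMap, barycenterWeight_flipMap hσ hτ hdisj hx, flipMap]
  module

variable [Fintype W] {K : Set (Finset W)}

theorem flipMap_mem_stdSimplex (hσ : σ.Nonempty) (hτ : τ.Nonempty) (hx : x ∈ stdSimplex ℝ W) :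
    flipMap hσ τ x ∈ stdSimplex ℝ W := by
  obtain ⟨u, -, hmin, hweight⟩ := exists_barycenterWeight_eq hσ x
  have hcard : (σ.card : ℝ) ≠ 0 := by exact_mod_cast hσ.card_pos.ne'
  have hnonneg : 0 ≤ barycenterWeight hσ x := hweight ▸ mul_nonneg (Nat.cast_nonneg _) (hx.1 u)
  have hτnonneg : ∀ v, 0 ≤ barycenterWeight hσ x * barycenter τ v := fun v =>
    mul_nonneg hnonneg (indicator_nonneg (fun _ _ => by positivity) v)
  refine ⟨fun v => ?_, ?_⟩
  · rw [flipMap_apply, mul_sub]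
    by_cases hv : v ∈ σ
    · have hσv : barycenterWeight hσ x * barycenter σ v = x u := by
        rw [barycenter_apply_of_mem hv, hweight, mul_right_comm, mul_inv_cancel₀ hcard, one_mul]
      linarith [hmin v hv, hτnonneg v]
    · rw [barycenter_apply_of_notMem hv, mul_zero]
      linarith [hx.1 v, hτnonneg v]
  · simp only [flipMap_apply, Finset.sum_add_distrib, ← Finset.mul_sum, Finset.sum_sub_distrib,
      sum_barycenter hσ, sum_barycenter hτ, hx.2]
    ring

theorem isPiecewiseLinear_flipMap (hK : IsLowerSet K) (hσ : σ.Nonempty) (τ : Finset W)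
    {t : Set (W → ℝ)} {f : geometricRealization K → t} (hf : ∀ x, (f x : W → ℝ) = flipMap hσ τ x) :
    IsPiecewiseLinear f := by
  let proj (u : W) : (W → ℝ) →ₗ[ℝ] ℝ := LinearMap.proj u
  refine ⟨(fun p : Finset W × W => closedFace p.1 ∩ {x | ∀ v : σ, 0 ≤ (proj v - proj p.2) x}) ''
    (K ×ˢ σ), (toFinite _).image _, ?_, ?_⟩
  · ext x
    simp only [← sUnion_closedFace hK, sUnion_image, mem_iUnion, exists_prop, Prod.exists, mem_prod]
    constructor
    · rintro ⟨F, u, ⟨hF, -⟩, hx, -⟩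
      exact ⟨F, hF, hx⟩
    · rintro ⟨F, hF, hx⟩
      obtain ⟨u, hu, hmin⟩ := σ.exists_min_image x hσ
      exact ⟨F, u, ⟨hF, hu⟩, hx, fun v => sub_nonneg.2 (hmin v v.2)⟩
  · rintro _ ⟨⟨F, u⟩, ⟨-, hu⟩, rfl⟩
    refine ⟨(isConvexPolyhedron_closedFace F).inter (isConvexPolyhedron_setOf_forall _), ?_⟩
    refine ⟨(LinearMap.id + ((σ.card : ℝ) • proj u).smulRight
      (barycenter τ - barycenter σ)).toAffineMap, ?_⟩
    rintro x ⟨-, hxu⟩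
    rw [hf, flipMap, barycenterWeight_eq_of_forall_le hσ hu fun v hv => sub_nonneg.1 (hxu ⟨v, hv⟩)]
    rfl

variable [DecidableEq W]

theorem IsFlippable.barycenterWeight_right_eq_zero (h : IsFlippable K σ τ)
    (hx : x ∈ geometricRealization K) : barycenterWeight h.right_nonempty x = 0 := by
  obtain ⟨hx, F, hF, hsupp⟩ := hx
  exact barycenterWeight_eq_zero _ hx.1 hsupp fun hτF => h.notMem (h.lower hτF hF)

theorem IsFlippable.flipMap_mem (h : IsFlippable K σ τ) (hx : x ∈ geometricRealization K) :
    flipMap h.left_nonempty τ x ∈ geometricRealization (bistellarFlip K σ τ) := by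
  obtain ⟨hx, F, hF, hsupp⟩ := hx
  have hσ := h.left_nonempty
  have hflip := flipMap_mem_stdSimplex hσ h.right_nonempty hx
  by_cases hσF : σ ⊆ F
  · obtain ⟨u, hu, -, hweight⟩ := exists_barycenterWeight_eq hσ x
    have hσcard : (0 : ℝ) < σ.card := by exact_mod_cast hσ.card_pos
    have hτcard : (0 : ℝ) < τ.card := by exact_mod_cast h.right_nonempty.card_pos
    have hpos : 0 < barycenterWeight hσ x :=
      hweight ▸ mul_pos hσcard ((hx.1 u).lt_of_ne' ((hsupp u).1 (hσF hu)))
    have hdisj := Finset.disjoint_left.1 h.disjoint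
    refine ⟨hflip, Finset.univ.filter (flipMap hσ τ x · ≠ 0), ?_, by simp⟩
    refine ⟨.inr ⟨fun v hv => ?_, fun v hv => ?_⟩, fun hall => ?_⟩
    · have hvσ : v ∉ σ := fun hvσ => hdisj hvσ hv
      rw [Finset.mem_filter_univ, flipMap_apply, barycenter_apply_of_mem hv,
        barycenter_apply_of_notMem hvσ, sub_zero]
      have := hx.1 v
      positivity
    · rw [Finset.mem_filter_univ] at hv
      by_contra hnot
      obtain ⟨hvσ, hvτ⟩ := not_or.1 (mt Finset.mem_union.2 hnot)
      rw [flipMap_apply, barycenter_apply_of_notMem hvσ, barycenter_apply_of_notMem hvτ, sub_zero,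
        mul_zero, add_zero, ← hsupp] at hv
      exact hnot (h.star F hF hσF hv)
    · refine (Finset.mem_filter_univ _).1 (hall hu) ?_
      rw [flipMap_apply, barycenter_apply_of_mem hu, barycenter_apply_of_notMem (hdisj hu), hweight]
      field_simp
      ring
  · have hfix : flipMap hσ τ x = x := by
      rw [flipMap, barycenterWeight_eq_zero hσ hx.1 hsupp hσF, zero_smul, add_zero]
    rw [hfix]
    exact ⟨hx, F, ⟨.inl hF, hσF⟩, hsupp⟩

theorem IsFlippable.plHomeomorphic (h : IsFlippable K σ τ) :
    PLHomeomorphic (geometricRealization (bistellarFlip K σ τ)) (geometricRealization K) := by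
  have hmem : ∀ x ∈ geometricRealization (bistellarFlip K σ τ),
      flipMap h.right_nonempty σ x ∈ geometricRealization K := fun x hx => by
    simpa only [h.flip_flip] using h.symm.flipMap_mem hx
  let e : geometricRealization (bistellarFlip K σ τ) ≃ₜ geometricRealization K :=
    { toFun x := ⟨flipMap h.right_nonempty σ x, hmem x x.2⟩
      invFun x := ⟨flipMap h.left_nonempty τ x, h.flipMap_mem x.2⟩
      left_inv x := Subtype.ext <|
        flipMap_flipMap _ _ h.disjoint.symm (h.symm.barycenterWeight_right_eq_zero x.2)
      right_inv x := Subtype.ext <|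
        flipMap_flipMap _ _ h.disjoint (h.barycenterWeight_right_eq_zero x.2)
      continuous_toFun := ((continuous_flipMap _ _).comp continuous_subtype_val).subtype_mk _
      continuous_invFun := ((continuous_flipMap _ _).comp continuous_subtype_val).subtype_mk _ }
  exact ⟨e, isPiecewiseLinear_flipMap h.isLowerSet_flip _ _ fun _ => rfl,
    isPiecewiseLinear_flipMap h.lower _ _ fun _ => rfl⟩

end FlipMap

section Families

variable {V : Type*} {K : Set (Finset V)} {d : ℕ}

/-- A family of finite sets all of whose realizations in coordinate spaces containing its vertices
are piecewise linear `d`-spheres. -/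
def IsPLSphereFamily (K : Set (Finset V)) (d : ℕ) : Prop :=
  ∀ (W : Type) [Fintype W] (e : W ↪ V), (∀ F ∈ K, F ⊆ Finset.univ.map e) →
    PLHomeomorphic (geometricRealization (Finset.map e ⁻¹' K))
      (AbstractSimplicialComplex.simplexBoundary d).realization

/-- The missing faces of size `q` of a family `K`. -/
def missingFaces (K : Set (Finset V)) (q : ℕ) : Set (Finset V) :=
  {F | Minimal (· ∉ K) F ∧ F.card = q}

theorem isLowerSet_preimage_map {W : Type*} (e : W ↪ V) (hK : IsLowerSet K) :
    IsLowerSet (Finset.map e ⁻¹' K) :=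
  hK.preimage fun _ _ h => Finset.map_subset_map.2 h

theorem exists_embedding_map_univ_eq {S : Finset V} {n : ℕ} (hS : S.card = n) :
    ∃ e : Fin n ↪ V, Finset.univ.map e = S :=
  ⟨(S.equivFinOfCardEq hS).symm.toEmbedding.trans (Function.Embedding.subtype _), by
    rw [← Finset.map_map, Finset.map_univ_equiv, Finset.univ_eq_attach]
    exact S.attach_map_val⟩

theorem isPLSphereFamily_Iio {S : Finset V} (hS : S.card = d + 2) :
    IsPLSphereFamily (Iio S) d := by
  intro W _ e he
  have hSe : S ⊆ Finset.univ.map e := fun v hv =>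
    he {v} (Finset.ssubset_iff_subset_ne.2 ⟨by simpa using hv, by rintro rfl; simp at hS⟩)
      (Finset.mem_singleton_self v)
  obtain ⟨T, -, rfl⟩ := Finset.subset_map_iff.1 hSe
  obtain ⟨e', rfl⟩ := exists_embedding_map_univ_eq ((T.card_map e).symm.trans hS)
  have hpull : Finset.map e ⁻¹' Iio ((Finset.univ.map e').map e) =
      Finset.map e' '' Iio Finset.univ := by
    ext F
    simp only [mem_preimage, mem_Iio, Finset.map_ssubset_map, mem_image]
    constructor
    · intro hF
      obtain ⟨G, -, rfl⟩ := Finset.subset_map_iff.1 hF.subset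
      exact ⟨G, Finset.map_ssubset_map.1 hF, rfl⟩
    · rintro ⟨G, hG, rfl⟩
      exact Finset.map_ssubset_map.2 hG
  have hreal : (AbstractSimplicialComplex.simplexBoundary d).realization =
      geometricRealization (Iio Finset.univ) := by
    rw [← geometricRealization_setOf_nonempty]
    simp only [mem_Iio, Finset.ssubset_univ_iff]
    rfl
  rw [hreal, hpull]
  exact plHomeomorphic_geometricRealization_image_map e' (isLowerSet_Iio _)
    (hpull ▸ isLowerSet_preimage_map e (isLowerSet_Iio _))

section Flip

variable [DecidableEq V]

theorem IsFlippable.preimage_map {W : Type*} [DecidableEq W] (e : W ↪ V) {σ τ : Finset W}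
    (h : IsFlippable K (σ.map e) (τ.map e)) : IsFlippable (Finset.map e ⁻¹' K) σ τ where
  lower := isLowerSet_preimage_map e h.lower
  disjoint := (Finset.disjoint_map e).1 h.disjoint
  left_nonempty := Finset.map_nonempty.1 h.left_nonempty
  right_nonempty := Finset.map_nonempty.1 h.right_nonempty
  star F hF hσF := by
    have := h.star _ hF (Finset.map_subset_map.2 hσF)
    rwa [← Finset.map_union, Finset.map_subset_map] at this
  mem F hF hτF := by
    refine h.mem _ ?_ (mt Finset.map_subset_map.1 hτF)
    rwa [← Finset.map_union, Finset.map_subset_map]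
  notMem := h.notMem

theorem IsPLSphereFamily.flip (hK : IsPLSphereFamily K d) {σ τ : Finset V}
    (h : IsFlippable K σ τ) (hσ : 2 ≤ σ.card) : IsPLSphereFamily (bistellarFlip K σ τ) d := by
  intro W _ e he
  classical
  have hKe : ∀ F ∈ K, F ⊆ Finset.univ.map e := fun F hF v hv => by
    refine he {v} ⟨.inl (h.lower (Finset.singleton_subset_iff.2 hv) hF), fun hσv => ?_⟩ (by simp)
    have := hσ.trans (Finset.card_le_card hσv)
    simp at this
  have hτσ : ¬ τ ⊆ σ := fun hτσ => h.right_nonempty.ne_empty (h.disjoint.symm.eq_bot_of_le hτσ)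
  have hστ : ¬ σ ⊆ τ := fun hστ => h.left_nonempty.ne_empty (h.disjoint.eq_bot_of_le hστ)
  obtain ⟨σ, -, rfl⟩ :=
    Finset.subset_map_iff.1 (hKe σ (h.mem σ Finset.subset_union_left hτσ))
  obtain ⟨τ, -, rfl⟩ :=
    Finset.subset_map_iff.1 (he τ ⟨.inr ⟨subset_rfl, Finset.subset_union_right⟩, hστ⟩)
  have hpull : Finset.map e ⁻¹' bistellarFlip K (σ.map e) (τ.map e) =
      bistellarFlip (Finset.map e ⁻¹' K) σ τ := by
    ext F
    simp only [mem_preimage, mem_bistellarFlip, ← Finset.map_union, Finset.map_subset_map]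
  rw [hpull]
  exact (h.preimage_map e).plHomeomorphic.trans (hK W e hKe)

end Flip

section ComplexOfFamily

variable {U : Type*} {L : Set (Finset U)}

/-- The simplicial complex with the nonempty members of `L` as faces. -/
def complexOfFamily (L : Set (Finset U)) (hL : IsLowerSet L) (hsingle : ∀ u, {u} ∈ L) :
    AbstractSimplicialComplex U where
  faces := {F | F.Nonempty ∧ F ∈ L}
  isRelLowerSet_faces _ hF := ⟨hF.1, fun _ hGF hG => ⟨hG, hL hGF hF.2⟩⟩
  singleton_mem u := ⟨Finset.singleton_nonempty u, hsingle u⟩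

theorem isFace_complexOfFamily [Nonempty U] {hL : IsLowerSet L} {hsingle : ∀ u, {u} ∈ L}
    {F : Finset U} : (complexOfFamily L hL hsingle).IsFace F ↔ F ∈ L := by
  have hempty : ∅ ∈ L := hL (Finset.empty_subset _) (hsingle (Classical.arbitrary U))
  constructor
  · rintro (rfl | hF)
    exacts [hempty, hF.2]
  · exact fun hF => F.eq_empty_or_nonempty.imp_right fun hne => ⟨hne, hF⟩

theorem faceCount_complexOfFamily [Fintype U] [Nonempty U] {hL : IsLowerSet L}
    {hsingle : ∀ u, {u} ∈ L} {k : ℕ} (hk : ∀ F : Finset U, F.card = k → F ∈ L) :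
    (complexOfFamily L hL hsingle).faceCount k = (Fintype.card U).choose k := by
  have hfaces : {F | (complexOfFamily L hL hsingle).IsFace F ∧ F.card = k} =
      ↑((Finset.univ : Finset U).powersetCard k) := by
    ext F
    simp only [mem_ofPred_eq, isFace_complexOfFamily, Finset.mem_coe, Finset.mem_powersetCard_univ]
    exact and_iff_right_of_imp (hk F)
  rw [AbstractSimplicialComplex.faceCount, hfaces, ncard_coe_finset, Finset.card_powersetCard,
    Finset.card_univ]

theorem isNeighborly_complexOfFamily [Finite U] [Nonempty U] {hL : IsLowerSet L}
    {hsingle : ∀ u, {u} ∈ L} {k : ℕ} (hk : ∀ F : Finset U, F.card = k → F ∈ L) :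
    (complexOfFamily L hL hsingle).IsNeighborly k := by
  cases nonempty_fintype U
  have hone : ∀ F : Finset U, F.card = 1 → F ∈ L := fun F hF => by
    obtain ⟨u, rfl⟩ := Finset.card_eq_one.1 hF
    exact hsingle u
  rw [AbstractSimplicialComplex.IsNeighborly, faceCount_complexOfFamily hk,
    faceCount_complexOfFamily hone, Nat.choose_one_right]

theorem missingFaceCount_complexOfFamily [Nonempty U] {hL : IsLowerSet L}
    {hsingle : ∀ u, {u} ∈ L} (i : ℕ) :
    (complexOfFamily L hL hsingle).missingFaceCount i = (missingFaces L (i + 1)).ncard := by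
  simp only [AbstractSimplicialComplex.missingFaceCount, AbstractSimplicialComplex.IsMissingFace,
    isFace_complexOfFamily, missingFaces, minimal_iff_forall_lt, not_not]

end ComplexOfFamily

theorem missingFaces_preimage_map {W : Type*} (e : W ↪ V) (q : ℕ) :
    missingFaces (Finset.map e ⁻¹' K) q = Finset.map e ⁻¹' missingFaces K q := by
  ext F
  simp only [missingFaces, minimal_iff_forall_lt, mem_preimage, mem_ofPred_eq, Finset.card_map,
    not_not]
  refine and_congr_left fun _ => and_congr_right fun _ => ⟨fun h G hG => ?_, fun h G hG => ?_⟩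
  · obtain ⟨G, -, rfl⟩ := Finset.subset_map_iff.1 hG.subset
    exact h (Finset.map_ssubset_map.1 hG)
  · exact h (Finset.map_ssubset_map.2 hG)

theorem singleton_mem_of_mem_missingFaces {q : ℕ} (hq : 2 ≤ q) {F : Finset V}
    (hF : F ∈ missingFaces K q) {v : V} (hv : v ∈ F) : {v} ∈ K := by
  refine not_not.1 (hF.1.not_prop_of_lt ?_)
  refine Finset.ssubset_iff_subset_ne.2 ⟨Finset.singleton_subset_iff.2 hv, ?_⟩
  rintro rfl
  have hcard := hF.2
  rw [Finset.card_singleton] at hcard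
  omega

theorem subset_of_mem_missingFaces {X : Finset V} (hKX : ∀ F ∈ K, F ⊆ X) {q : ℕ} (hq : 2 ≤ q)
    {F : Finset V} (hF : F ∈ missingFaces K q) : F ⊆ X := fun _ hv =>
  Finset.singleton_subset_iff.1 (hKX _ (singleton_mem_of_mem_missingFaces hq hF hv))

theorem missingFaces_Iio {S : Finset V} {q : ℕ} (hq : 2 ≤ q) (hS : S.card ≠ q) :
    missingFaces (Iio S) q = ∅ :=
  eq_empty_of_forall_notMem fun F hF => hS <| by
    have hFS : F ⊆ S := subset_of_mem_missingFaces (fun _ hG => hG.subset) hq hF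
    rw [← hF.2, hFS.eq_of_not_ssubset hF.1.prop]

theorem finite_missingFaces (hKX : ∀ F ∈ K, F ⊆ X) {q : ℕ} (hq : 2 ≤ q) :
    (missingFaces K q).Finite :=
  X.powerset.finite_toSet.subset fun _ hF =>
    Finset.mem_coe.2 (Finset.mem_powerset.2 (subset_of_mem_missingFaces hKX hq hF))

theorem ncard_missingFaces_preimage_map {W : Type*} [Fintype W] (e : W ↪ V)
    (he : ∀ F ∈ K, F ⊆ Finset.univ.map e) {q : ℕ} (hq : 2 ≤ q) :
    (missingFaces (Finset.map e ⁻¹' K) q).ncard = (missingFaces K q).ncard := by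
  rw [missingFaces_preimage_map]
  refine ncard_preimage_of_injective_subset_range (Finset.map_injective e) fun F hF => ?_
  obtain ⟨G, -, rfl⟩ := Finset.subset_map_iff.1 (subset_of_mem_missingFaces he hq hF)
  exact mem_range_self G

theorem exists_complex_of_isPLSphereFamily {X : Finset V} {n k i : ℕ} (hX : X.card = n)
    (hlow : IsLowerSet K) (hKX : ∀ F ∈ K, F ⊆ X) (hk : 1 ≤ k) (hkn : k ≤ n)
    (hface : ∀ F ⊆ X, F.card = k → F ∈ K) (hPL : IsPLSphereFamily K d) (hi : 1 ≤ i) :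
    ∃ Δ : AbstractSimplicialComplex (Fin n), Δ.IsPLSphere d ∧ Δ.IsNeighborly k ∧
      Δ.missingFaceCount i = (missingFaces K (i + 1)).ncard := by
  obtain ⟨e, rfl⟩ := exists_embedding_map_univ_eq hX
  have : NeZero n := ⟨by omega⟩
  have hlow' : IsLowerSet (Finset.map e ⁻¹' K) := isLowerSet_preimage_map e hlow
  have hface' : ∀ F : Finset (Fin n), F.card = k → F ∈ Finset.map e ⁻¹' K := fun F hF =>
    hface _ (Finset.map_subset_map.2 F.subset_univ) (by simpa using hF)
  have hsingle : ∀ u, {u} ∈ Finset.map e ⁻¹' K := fun u => by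
    obtain ⟨F, huF, hF⟩ :=
      Finset.exists_superset_card_eq (s := {u}) (n := k) (by simpa) (by simpa)
    exact hlow' huF (hface' F hF)
  refine ⟨complexOfFamily _ hlow' hsingle, ?_, isNeighborly_complexOfFamily hface', ?_⟩
  · have hreal : (complexOfFamily _ hlow' hsingle).realization =
        geometricRealization (Finset.map e ⁻¹' K) :=
      geometricRealization_setOf_nonempty
    rw [AbstractSimplicialComplex.IsPLSphere, hreal]
    exact hPL _ e hKX
  · rw [missingFaceCount_complexOfFamily, ncard_missingFaces_preimage_map e hKX (by omega)]

end Families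

section Coning

variable {V : Type*} [DecidableEq V] {K L B I : Set (Finset V)} {P S : Finset V} {v w : V}

/-- The family obtained from `K` by replacing a ball by the cone with apex `v` over its boundary.
The ball is given by the set `B` of its faces and the set `I` of its interior faces. -/
def replaceByCone (K B I : Set (Finset V)) (v : V) : Set (Finset V) :=
  {G | v ∉ G ∧ G ∈ K \ I} ∪ {G | v ∈ G ∧ G.erase v ∈ B \ I}

/-- `B` and `I` are the faces and the interior faces of a ball built up from facets of `K` by a
shelling: the new facet `P` meets the previous ones in the faces not containing `S`, so that the
new interior faces are those between `P \ S` and `P`. -/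
inductive IsShellableBall (K : Set (Finset V)) : Set (Finset V) → Set (Finset V) → Prop
  | empty : IsShellableBall K ∅ ∅
  | add_facet {B I : Set (Finset V)} {P S : Finset V} (ball : IsShellableBall K B I)
      (mem : P ∈ K) (subset : S ⊆ P) (card : 1 < (P \ S).card)
      (mem_iff : ∀ F ⊆ P, F ∈ B ↔ ¬ S ⊆ F) (star : ∀ G ∈ K, P \ S ⊆ G → G ⊆ P ∨ G ∈ I) :
      IsShellableBall K (B ∪ Iic P) (I ∪ Icc (P \ S) P)

namespace IsShellableBall

theorem subset (hK : IsLowerSet K) (h : IsShellableBall K B I) : B ⊆ K := by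
  induction h with
  | empty => exact empty_subset K
  | add_facet _ hP _ _ _ _ ih => exact union_subset ih fun _ hF => hK hF hP

theorem interior_subset (h : IsShellableBall K B I) : I ⊆ B := by
  induction h with
  | empty => exact subset_rfl
  | add_facet _ _ _ _ _ _ ih => exact union_subset_union ih Icc_subset_Iic_self

theorem mem_interior_of_subset (h : IsShellableBall K B I) {F G : Finset V}
    (hF : F ∈ I) (hFG : F ⊆ G) (hG : G ∈ K) : G ∈ I := by
  induction h with
  | empty => exact hF
  | add_facet _ _ _ _ _ hstar ih =>
    rcases hF with hF | hF
    · exact .inl (ih hF)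
    · exact (hstar G hG (hF.1.trans hFG)).symm.imp_right fun hGP => ⟨hF.1.trans hFG, hGP⟩

end IsShellableBall

theorem isFlippable_replaceByCone (hK : IsLowerSet K) (hv : ∀ F ∈ K, v ∉ F)
    (h : IsShellableBall K B I) (hP : P ∈ K) (hS : S ⊆ P) (hcard : 1 < (P \ S).card)
    (hB : ∀ F ⊆ P, F ∈ B ↔ ¬ S ⊆ F) (hstar : ∀ G ∈ K, P \ S ⊆ G → G ⊆ P ∨ G ∈ I)
    (hlow : IsLowerSet (replaceByCone K B I v)) :
    IsFlippable (replaceByCone K B I v) (P \ S) (insert v S) := by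
  have hPI : P ∉ I := fun hPI => (hB P subset_rfl).1 (h.interior_subset hPI) hS
  have hFI : ∀ F ⊆ P, F ∉ I := fun F hF hFI => hPI (h.mem_interior_of_subset hFI hF hP)
  have hvσ : v ∉ P \ S := fun hvσ => hv P hP (Finset.sdiff_subset hvσ)
  have hunion : P \ S ∪ insert v S = insert v P := by
    rw [Finset.union_insert, Finset.sdiff_union_of_subset hS]
  refine ⟨hlow, Finset.disjoint_insert_right.2 ⟨hvσ, Finset.sdiff_disjoint⟩,
    Finset.card_pos.1 (by omega), Finset.insert_nonempty _ _, ?_, ?_, ?_⟩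
  · rintro G (⟨-, hGK, hGI⟩ | ⟨-, hGB, hGI⟩) hσG <;> rw [hunion]
    · exact ((hstar G hGK hσG).resolve_right hGI).trans (Finset.subset_insert v P)
    · exact Finset.subset_insert_iff.2 <|
        (hstar _ (h.subset hK hGB) (Finset.subset_erase.2 ⟨hσG, hvσ⟩)).resolve_right hGI
  · intro F hF hτF
    rw [hunion, Finset.subset_insert_iff] at hF
    by_cases hvF : v ∈ F
    · refine .inr ⟨hvF, (hB _ hF).2 fun hSF => hτF ?_, hFI _ hF⟩
      exact Finset.insert_subset hvF (hSF.trans (Finset.erase_subset v F))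
    · rw [Finset.erase_eq_of_notMem hvF] at hF
      exact .inl ⟨hvF, hK hF hP, hFI F hF⟩
  · rintro (⟨hvτ, -⟩ | ⟨-, hSB, -⟩)
    · exact hvτ (Finset.mem_insert_self v S)
    · rw [Finset.erase_insert fun hvS => hv P hP (hS hvS)] at hSB
      exact (hB S hS).1 hSB subset_rfl

theorem bistellarFlip_replaceByCone (hK : IsLowerSet K) (hv : ∀ F ∈ K, v ∉ F)
    (h : IsShellableBall K B I) (hP : P ∈ K) (hS : S ⊆ P)
    (hB : ∀ F ⊆ P, F ∈ B ↔ ¬ S ⊆ F) (hstar : ∀ G ∈ K, P \ S ⊆ G → G ⊆ P ∨ G ∈ I) :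
    bistellarFlip (replaceByCone K B I v) (P \ S) (insert v S) =
      replaceByCone K (B ∪ Iic P) (I ∪ Icc (P \ S) P) v := by
  have hPI : P ∉ I := fun hPI => (hB P subset_rfl).1 (h.interior_subset hPI) hS
  have hFI : ∀ F ⊆ P, F ∉ I := fun F hF hFI => hPI (h.mem_interior_of_subset hFI hF hP)
  have hvP : v ∉ P := hv P hP
  ext G
  by_cases hvG : v ∈ G
  · have hσ : P \ S ⊆ G ↔ P \ S ⊆ G.erase v := by grind
    have hτ : insert v S ⊆ G ∧ G ⊆ P \ S ∪ insert v S ↔ S ⊆ G.erase v ∧ G.erase v ⊆ P := by grind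
    have hBK : G.erase v ∈ B → G.erase v ∈ K := fun hG => h.subset hK hG
    simp only [mem_bistellarFlip, replaceByCone, hσ, hτ, hvG, mem_union, mem_ofPred_eq, mem_sdiff,
      mem_Iic, mem_Icc, not_true_eq_false, false_and, true_and, false_or]
    grind
  · have hτ : ¬ insert v S ⊆ G := fun hτG => hvG (hτG (Finset.mem_insert_self v S))
    simp only [mem_bistellarFlip, replaceByCone, hτ, hvG, mem_union, mem_ofPred_eq, mem_sdiff,
      mem_Icc, not_false_eq_true, false_and, true_and, or_false]
    grind

theorem replaceByCone_empty (hv : ∀ F ∈ K, v ∉ F) : replaceByCone K ∅ ∅ v = K := by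
  ext G
  simpa [replaceByCone] using hv G

theorem IsShellableBall.replaceByCone {d : ℕ} (hK : IsLowerSet K) (hv : ∀ F ∈ K, v ∉ F)
    (hPL : IsPLSphereFamily K d) (h : IsShellableBall K B I) :
    IsLowerSet (replaceByCone K B I v) ∧ IsPLSphereFamily (replaceByCone K B I v) d := by
  induction h with
  | empty => rw [replaceByCone_empty hv]; exact ⟨hK, hPL⟩
  | add_facet ball hP hS hcard hB hstar ih =>
    have hflip := isFlippable_replaceByCone hK hv ball hP hS hcard hB hstar ih.1
    rw [← bistellarFlip_replaceByCone hK hv ball hP hS hB hstar]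
    exact ⟨hflip.isLowerSet_flip, ih.2.flip hflip hcard⟩

/-- The faces of the cone with apex `w` over a family `B`. -/
def coneFaces (w : V) (B : Set (Finset V)) : Set (Finset V) := {F | F.erase w ∈ B}

/-- The interior faces of the cone with apex `w` over a ball with interior faces `I`. The cone has
the ball itself in its boundary. -/
def coneInterior (w : V) (I : Set (Finset V)) : Set (Finset V) := {F | w ∈ F ∧ F.erase w ∈ I}

theorem IsShellableBall.cone (h : IsShellableBall L B I) (hw : ∀ F ∈ B, w ∉ F)
    (hmem : ∀ F ∈ B, insert w F ∈ K) (hstar : ∀ F ∈ I, ∀ G ∈ K, insert w F ⊆ G → G.erase w ∈ L) :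
    IsShellableBall K (coneFaces w B) (coneInterior w I) := by
  induction h with
  | empty => simpa [coneFaces, coneInterior] using IsShellableBall.empty (K := K)
  | @add_facet B I P S _ _ hS hcard hB hPstar ih =>
    have hwP : w ∉ P := hw P (.inr self_mem_Iic)
    have hsdiff : insert w P \ S = insert w (P \ S) :=
      Finset.insert_sdiff_of_notMem _ fun hwS => hwP (hS hwS)
    have hfaces : coneFaces w (B ∪ Iic P) = coneFaces w B ∪ Iic (insert w P) := by
      ext F
      simp [coneFaces, Finset.subset_insert_iff]
    have hinterior : coneInterior w (I ∪ Icc (P \ S) P) =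
        coneInterior w I ∪ Icc (insert w P \ S) (insert w P) := by
      ext F
      simp only [coneInterior, mem_union, mem_ofPred_eq, mem_Icc, hsdiff]
      grind
    rw [hfaces, hinterior]
    refine add_facet (ih (fun F hF => hw F (.inl hF)) (fun F hF => hmem F (.inl hF))
      fun F hF => hstar F (.inl hF)) (hmem P (.inr self_mem_Iic))
      (hS.trans (Finset.subset_insert w P)) ?_ (fun F hF => ?_) fun G hG hPG => ?_
    · rw [hsdiff]
      exact hcard.trans_le (Finset.card_le_card (Finset.subset_insert w _))
    · rw [coneFaces, mem_ofPred_eq, hB _ (Finset.subset_insert_iff.1 hF), Finset.subset_erase,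
        and_iff_left fun hwS => hwP (hS hwS)]
    · rw [hsdiff] at hPG
      have hGL := hstar (P \ S) (.inr (left_mem_Icc.2 Finset.sdiff_subset)) G hG hPG
      have hwG : w ∈ G := hPG (Finset.mem_insert_self _ _)
      rw [Finset.subset_insert_iff]
      refine (hPstar _ hGL (Finset.subset_erase.2 ⟨?_, ?_⟩)).imp_right fun hGI => ⟨hwG, hGI⟩
      · exact (Finset.subset_insert w _).trans hPG
      · exact fun hwS => hwP (Finset.sdiff_subset hwS)

theorem mem_replaceByCone_of_notMem {F : Finset V} (hvF : v ∉ F) :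
    F ∈ replaceByCone K B I v ↔ F ∈ K ∧ F ∉ I := by
  simp [replaceByCone, hvF]

theorem mem_replaceByCone_of_mem {F : Finset V} (hvF : v ∈ F) :
    F ∈ replaceByCone K B I v ↔ F.erase v ∈ B ∧ F.erase v ∉ I := by
  simp [replaceByCone, hvF]

theorem notMem_of_mem_missingFaces_replaceByCone {q : ℕ}
    (hB : ∀ F ∈ K, F.card + 1 = q → (∀ G ⊂ F, G ∈ B) → F ∈ B) {F : Finset V}
    (hF : F ∈ missingFaces (replaceByCone K B I v) q) : v ∉ F := by
  intro hvF
  have hmem : F.erase v ∈ K ∧ F.erase v ∉ I := (mem_replaceByCone_of_notMem (by simp)).1 <|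
    not_not.1 (hF.1.not_prop_of_lt (Finset.erase_ssubset hvF))
  refine hF.1.prop ((mem_replaceByCone_of_mem hvF).2 ⟨hB _ hmem.1 ?_ fun G hG => ?_, hmem.2⟩)
  · rw [Finset.card_erase_add_one hvF, hF.2]
  · have hvG : v ∉ G := fun hvG => by simpa using hG.subset hvG
    have hlt : insert v G ⊂ F := by grind
    have hGB := (mem_replaceByCone_of_mem (Finset.mem_insert_self v G)).1 <|
      not_not.1 (hF.1.not_prop_of_lt hlt)
    rw [Finset.erase_insert hvG] at hGB
    exact hGB.1

/-- The sets with `q` elements that are minimal in the family `I`. -/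
def minimalFaces (I : Set (Finset V)) (q : ℕ) : Set (Finset V) :=
  {F | Minimal (· ∈ I) F ∧ F.card = q}

theorem missingFaces_replaceByCone (hK : IsLowerSet K) (hv : ∀ F ∈ K, v ∉ F) (hIK : I ⊆ K)
    {q : ℕ} (hq : 2 ≤ q) (hB : ∀ F ∈ K, F.card + 1 = q → (∀ G ⊂ F, G ∈ B) → F ∈ B)
    (hI : ∀ F ∈ missingFaces K q, ∀ G ∈ I, ¬ G ⊆ F) :
    missingFaces (replaceByCone K B I v) q = missingFaces K q ∪ minimalFaces I q := by
  ext F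
  by_cases hvF : v ∈ F
  · refine iff_of_false
      (fun hF => notMem_of_mem_missingFaces_replaceByCone hB hF hvF) ?_
    rintro (hF | ⟨hF, -⟩)
    · exact hv {v} (singleton_mem_of_mem_missingFaces hq hF hvF) (Finset.mem_singleton_self v)
    · exact hv F (hIK hF.prop) hvF
  · have hsub : ∀ G ⊂ F, G ∈ replaceByCone K B I v ↔ G ∈ K ∧ G ∉ I := fun G hG =>
      mem_replaceByCone_of_notMem fun hvG => hvF (hG.subset hvG)
    have hFK : F ∈ I → ∀ G ⊂ F, G ∈ K := fun hF G hG => hK hG.subset (hIK hF)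
    have hFI : F ∉ K → F ∉ I := fun hF hFI => hF (hIK hFI)
    have hI' : F ∈ missingFaces K q → ∀ G ⊂ F, G ∉ I := fun hF G hG hGI =>
      hI F hF G hGI hG.subset
    simp only [missingFaces, minimalFaces, minimal_iff_forall_lt, mem_union, mem_ofPred_eq, not_not,
      mem_replaceByCone_of_notMem hvF] at hI' ⊢
    grind

end Coning

section ConeSpheres

variable {V : Type*} [DecidableEq V] {K L B I B' I' : Set (Finset V)} {X : Finset V} {v w w' : V}
  {n m : ℕ}

/-- `K` is a `2`-neighborly sphere with vertex set `X` of size `n` and with `m` missing tetrahedra.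
It contains the cone with apex `w` over a ball, given by its faces `B` and interior faces `I`; this
ball contains all other vertices, and `w` belongs to no missing tetrahedron. -/
structure IsConeSphere (K : Set (Finset V)) (X : Finset V) (w : V) (B I : Set (Finset V))
    (n m : ℕ) : Prop where
  lower : IsLowerSet K
  subset : ∀ F ∈ K, F ⊆ X
  card : X.card = n
  apex_mem : w ∈ X
  edge : ∀ F ⊆ X, F.card = 2 → F ∈ K
  sphere : IsPLSphereFamily K 4
  missing : (missingFaces K 4).ncard = m
  apex_notMem : ∀ F ∈ missingFaces K 4, w ∉ F
  ball_notMem : ∀ F ∈ B, w ∉ F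
  insert_mem : ∀ F ∈ B, insert w F ∈ K
  star : ∀ F ∈ I, ∀ G ∈ K, insert w F ⊆ G → G.erase w ∈ B
  spanning : ∀ v ∈ X, v ≠ w → {v} ∈ B

/-- The ball with faces `B'` and interior faces `I'` arises from the ball with faces `B` and
interior faces `I` by adding a cone with apex `w` over a part of its boundary. -/
structure IsExtension (B I : Set (Finset V)) (w : V) (B' I' : Set (Finset V)) : Prop where
  notMem : ∀ F ∈ B, w ∉ F
  mono : B ⊆ B'
  mem : {w} ∈ B'
  erase_mem : ∀ F ∈ B', F.erase w ∈ B
  erase_notMem : ∀ F ∈ B', w ∈ F → F.erase w ∉ I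
  star : ∀ F ∈ I', ∀ T ∈ B, T ∉ I → F.erase w ⊆ T → insert w T ∈ B'

theorem minimalFaces_coneInterior (hw : ∀ F ∈ I, w ∉ F) (q : ℕ) :
    minimalFaces (coneInterior w I) (q + 1) = insert w '' minimalFaces I q := by
  ext F
  simp only [minimalFaces, mem_image, mem_ofPred_eq]
  constructor
  · rintro ⟨hF, hcard⟩
    have hwF : w ∈ F := hF.prop.1
    refine ⟨F.erase w, ⟨⟨hF.prop.2, fun G hG hGF => ?_⟩, ?_⟩, Finset.insert_erase hwF⟩
    · refine Finset.subset_insert_iff.1 (hF.le_of_le (y := insert w G) ?_ ?_)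
      · exact ⟨Finset.mem_insert_self w G, by rwa [Finset.erase_insert (hw G hG)]⟩
      · exact Finset.insert_subset hwF (hGF.trans (Finset.erase_subset w F))
    · rw [Finset.card_erase_of_mem hwF, hcard, Nat.add_sub_cancel]
  · rintro ⟨G, ⟨hG, rfl⟩, rfl⟩
    have hwG := hw G hG.prop
    refine ⟨⟨⟨Finset.mem_insert_self w G, ?_⟩, ?_⟩, Finset.card_insert_of_notMem hwG⟩
    · rw [Finset.erase_insert hwG]
      exact hG.prop
    · rintro F ⟨hwF, hF⟩ hFG
      rw [← Finset.insert_erase hwF]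
      exact Finset.insert_subset_insert w (hG.le_of_le hF (Finset.subset_insert_iff.1 hFG))

theorem edge_mem_replaceByCone (hB : ∀ v ∈ X, {v} ∈ B) (hI : ∀ F ∈ I, 2 < F.card)
    (hedge : ∀ F ⊆ X, F.card = 2 → F ∈ K) {F : Finset V} (hFX : F ⊆ insert v X)
    (hF : F.card = 2) : F ∈ replaceByCone K B I v := by
  by_cases hvF : v ∈ F
  · obtain ⟨u, hu⟩ := Finset.card_eq_one.1 (show (F.erase v).card = 1 by
      rw [Finset.card_erase_of_mem hvF, hF])
    have huX : {u} ⊆ X := by rwa [← hu, ← Finset.subset_insert_iff]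
    rw [mem_replaceByCone_of_mem hvF, hu]
    refine ⟨hB u (Finset.singleton_subset_iff.1 huX), fun huI => ?_⟩
    simpa using hI _ huI
  · refine (mem_replaceByCone_of_notMem hvF).2 ⟨hedge F ?_ hF, fun hFI => (hI F hFI).ne' hF⟩
    exact (Finset.subset_insert_iff_of_notMem hvF).1 hFX

theorem subset_of_mem_replaceByCone (hKX : ∀ F ∈ K, F ⊆ X) (hBK : B ⊆ K) {F : Finset V}
    (hF : F ∈ replaceByCone K B I v) : F ⊆ insert v X := by
  rcases hF with ⟨-, hF, -⟩ | ⟨-, hF, -⟩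
  · exact (hKX F hF).trans (Finset.subset_insert v X)
  · exact Finset.subset_insert_iff.2 (hKX _ (hBK hF))

namespace IsConeSphere

theorem coneFaces_subset (h : IsConeSphere K X w B I n m) : coneFaces w B ⊆ K := fun _ hF =>
  h.lower (Finset.subset_insert_iff.2 subset_rfl) (h.insert_mem _ hF)

theorem singleton_mem_coneFaces (h : IsConeSphere K X w B I n m) (hempty : ∅ ∈ B) {v : V}
    (hv : v ∈ X) : {v} ∈ coneFaces w B := by
  by_cases hvw : v = w
  · simpa [coneFaces, hvw] using hempty
  · rw [coneFaces, mem_ofPred_eq, Finset.erase_eq_of_notMem (by simpa using Ne.symm hvw)]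
    exact h.spanning v hv hvw

theorem notMem_of_isExtension (h : IsConeSphere K X w B I n m) (hext : IsExtension B I w B' I')
    (hw' : ∀ F ∈ B', w' ∉ F) : w' ∉ X := fun hw'X =>
  if hww' : w' = w then hw' _ hext.mem (by simp [hww'])
  else hw' _ (hext.mono (h.spanning w' hw'X hww')) (Finset.mem_singleton_self w')

theorem missingFaces_replaceByCone (h : IsConeSphere K X w B I n m) (hball : IsShellableBall L B I)
    (hB : ∀ T : Finset V, T.card = 3 → (∀ G ⊂ T, G ∈ B) → T ∈ B) (hw' : w' ∉ X) :
    missingFaces (replaceByCone K (coneFaces w B) (coneInterior w I) w') 4 =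
      missingFaces K 4 ∪ insert w '' minimalFaces I 3 := by
  have hIB := hball.interior_subset
  have hIK : coneInterior w I ⊆ K := fun F hF => h.coneFaces_subset (hIB hF.2)
  have hcone : ∀ F ∈ K, F.card + 1 = 4 → (∀ G ⊂ F, G ∈ coneFaces w B) → F ∈ coneFaces w B := by
    intro F _ hcard hF
    by_cases hwF : w ∈ F
    · simpa [coneFaces] using hF _ (Finset.erase_ssubset hwF)
    · rw [coneFaces, mem_ofPred_eq, Finset.erase_eq_of_notMem hwF]
      refine hB F (by omega) fun G hG => ?_
      have hwG : w ∉ G := fun hwG => hwF (hG.subset hwG)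
      simpa [coneFaces, Finset.erase_eq_of_notMem hwG] using hF G hG
  rw [_root_.missingFaces_replaceByCone h.lower (fun F hF hw'F => hw' (h.subset F hF hw'F)) hIK
    (by norm_num) hcone fun F hF G hG hGF => h.apex_notMem F hF (hGF hG.1),
    minimalFaces_coneInterior fun F hF => h.ball_notMem F (hIB hF)]

theorem finite_interior (h : IsConeSphere K X w B I n m) (hIB : I ⊆ B) : I.Finite :=
  X.powerset.finite_toSet.subset fun F hF => Finset.mem_coe.2 <| Finset.mem_powerset.2 <|
    (Finset.subset_insert w F).trans (h.subset _ (h.insert_mem F (hIB hF)))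

theorem ncard_missingFaces_replaceByCone (h : IsConeSphere K X w B I n m)
    (hball : IsShellableBall L B I) (hB : ∀ T : Finset V, T.card = 3 → (∀ G ⊂ T, G ∈ B) → T ∈ B)
    (hw' : w' ∉ X) :
    (missingFaces (replaceByCone K (coneFaces w B) (coneInterior w I) w') 4).ncard =
      m + (minimalFaces I 3).ncard := by
  have hwI : ∀ F ∈ I, w ∉ F := fun F hF => h.ball_notMem F (hball.interior_subset hF)
  have hinj : InjOn (insert w) (minimalFaces I 3) := fun T hT T' hT' hTT' => by
    rw [← Finset.erase_insert (hwI T hT.1.prop), hTT', Finset.erase_insert (hwI T' hT'.1.prop)]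
  have hdisj : Disjoint (missingFaces K 4) (insert w '' minimalFaces I 3) := by
    rw [disjoint_left]
    rintro F hF ⟨T, -, rfl⟩
    exact h.apex_notMem _ hF (Finset.mem_insert_self w T)
  have hfin : (minimalFaces I 3).Finite :=
    (h.finite_interior hball.interior_subset).subset fun _ hT => hT.1.prop
  rw [h.missingFaces_replaceByCone hball hB hw', ncard_union_eq hdisj
    (finite_missingFaces h.subset (by norm_num)) (hfin.image _), h.missing, hinj.ncard_image]

theorem erase_mem_of_mem_replaceByCone (hext : IsExtension B I w B' I') (hIB' : I' ⊆ B')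
    (hw' : ∀ F ∈ B', w' ∉ F) {F G : Finset V} (hF : F ∈ I')
    (hG : G ∈ replaceByCone K (coneFaces w B) (coneInterior w I) w') (hFG : insert w' F ⊆ G) :
    G.erase w' ∈ B' := by
  have hw'G : w' ∈ G := hFG (Finset.mem_insert_self w' F)
  have hFG' : F ⊆ G.erase w' :=
    Finset.subset_erase.2 ⟨(Finset.subset_insert w' F).trans hFG, hw' F (hIB' hF)⟩
  obtain ⟨hGB, hGI⟩ := (mem_replaceByCone_of_mem hw'G).1 hG
  by_cases hwG : w ∈ G.erase w'
  · rw [← Finset.insert_erase hwG]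
    exact hext.star F hF _ hGB (fun hGI' => hGI ⟨hwG, hGI'⟩) (Finset.erase_subset_erase w hFG')
  · rw [coneFaces, mem_ofPred_eq, Finset.erase_eq_of_notMem hwG] at hGB
    exact hext.mono hGB

theorem replaceByCone (h : IsConeSphere K X w B I n m) (hL : IsLowerSet L)
    (hball : IsShellableBall L B I)
    (hB : ∀ T : Finset V, T.card = 3 → (∀ G ⊂ T, G ∈ B) → T ∈ B) (hI : ∀ F ∈ I, 2 ≤ F.card)
    (hext : IsExtension B I w B' I') (hIB' : I' ⊆ B') (hw' : ∀ F ∈ B', w' ∉ F) :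
    IsConeSphere (replaceByCone K (coneFaces w B) (coneInterior w I) w') (insert w' X) w' B' I'
      (n + 1) (m + (minimalFaces I 3).ncard) := by
  have hw'X := h.notMem_of_isExtension hext hw'
  have hww' : w' ≠ w := fun hww' => hw'X (hww' ▸ h.apex_mem)
  have hcone : IsShellableBall K (coneFaces w B) (coneInterior w I) :=
    hball.cone h.ball_notMem h.insert_mem fun F hF G hG hFG =>
      hball.subset hL (h.star F hF G hG hFG)
  have hsphere := hcone.replaceByCone h.lower (fun F hF hw'F => hw'X (h.subset F hF hw'F)) h.sphere
  have hempty : ∅ ∈ B := by simpa using hext.erase_mem _ hext.mem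
  have hconeInterior : ∀ F ∈ coneInterior w I, 2 < F.card := fun F hF => by
    have := hI _ hF.2
    have := Finset.card_erase_lt_of_mem hF.1
    omega
  refine ⟨hsphere.1, fun F => subset_of_mem_replaceByCone h.subset h.coneFaces_subset, ?_,
    Finset.mem_insert_self w' X, fun F => edge_mem_replaceByCone
      (fun v => h.singleton_mem_coneFaces hempty) hconeInterior h.edge, hsphere.2,
    h.ncard_missingFaces_replaceByCone hball hB hw'X, fun F hF hw'F => ?_, hw', fun F hF => ?_,
    fun F hF G hG => erase_mem_of_mem_replaceByCone hext hIB' hw' hF hG, fun v hv hvw' => ?_⟩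
  · rw [Finset.card_insert_of_notMem hw'X, h.card]
  · rw [h.missingFaces_replaceByCone hball hB hw'X] at hF
    rcases hF with hF | ⟨T, hT, rfl⟩
    · exact hw'X (subset_of_mem_missingFaces h.subset (by norm_num) hF hw'F)
    · exact hw' T (hext.mono (hball.interior_subset hT.1.prop))
        (Finset.mem_of_mem_insert_of_ne hw'F hww')
  · rw [mem_replaceByCone_of_mem (Finset.mem_insert_self w' F), Finset.erase_insert (hw' F hF)]
    exact ⟨hext.erase_mem F hF, fun hFI => hext.erase_notMem F hF hFI.1 hFI.2⟩
  · by_cases hvw : v = w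
    · exact hvw ▸ hext.mem
    · exact hext.mono (h.spanning v (Finset.mem_of_mem_insert_of_ne hv hvw') hvw)

end IsConeSphere

/-- Cone spheres over a ball exist for every choice of the apex. -/
def HasConeSphere (B I : Set (Finset V)) (n m : ℕ) : Prop :=
  ∀ w, (∀ F ∈ B, w ∉ F) → ∃ K X, IsConeSphere K X w B I n m

end ConeSpheres

section Grid

variable {ι : Type*} [Fintype ι] [DecidableEq ι] {R R' C : Set (ι → ℤ)} {c : ι → ℤ}
  {F G S : Finset (ι × ℤ)} {a : ι} {x : ℤ}

/-- The facet indexed by `c` of the join of lines, one for each element of `ι`, triangulated with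
vertex set `ℤ`: it is the join of the edges `{c a, c a + 1}`. -/
def gridCell (c : ι → ℤ) : Finset (ι × ℤ) :=
  (Finset.univ ×ˢ {0, 1}).image fun p => (p.1, c p.1 + p.2)

/-- The faces of the cells of the region `R`. -/
def regionFaces (R : Set (ι → ℤ)) : Set (Finset (ι × ℤ)) := {F | ∃ c ∈ R, F ⊆ gridCell c}

/-- The faces meeting every line that lie only in cells of the region `R`. If `R` is a ball, these
are its interior faces. -/
def regionInterior (R : Set (ι → ℤ)) : Set (Finset (ι × ℤ)) :=
  {F | (∀ a, ∃ x, (a, x) ∈ F) ∧ F ∈ regionFaces univ ∧ ∀ c, F ⊆ gridCell c → c ∈ R}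

theorem mem_gridCell {v : ι × ℤ} : v ∈ gridCell c ↔ v.2 = c v.1 ∨ v.2 = c v.1 + 1 := by
  simp only [gridCell, Finset.mem_image, Finset.mem_product, Finset.mem_univ, true_and,
    Finset.mem_insert, Finset.mem_singleton, Prod.ext_iff, Prod.exists]
  constructor
  · rintro ⟨a, e, rfl | rfl, rfl, h⟩ <;> omega
  · rintro (h | h)
    exacts [⟨v.1, 0, .inl rfl, rfl, by omega⟩, ⟨v.1, 1, .inr rfl, rfl, by omega⟩]

theorem isLowerSet_regionFaces (R : Set (ι → ℤ)) : IsLowerSet (regionFaces R) :=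
  fun _ _ hGF ⟨c, hc, hF⟩ => ⟨c, hc, hGF.trans hF⟩

theorem regionFaces_mono (h : R ⊆ R') : regionFaces R ⊆ regionFaces R' :=
  fun _ ⟨c, hc, hF⟩ => ⟨c, h hc, hF⟩

theorem regionInterior_mono (h : R ⊆ R') : regionInterior R ⊆ regionInterior R' :=
  fun _ ⟨hspan, hF, hR⟩ => ⟨hspan, hF, fun c hc => h (hR c hc)⟩

theorem regionInterior_subset (R : Set (ι → ℤ)) : regionInterior R ⊆ regionFaces R :=
  fun _ ⟨_, ⟨c, _, hc⟩, hR⟩ => ⟨c, hR c hc, hc⟩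

theorem mem_regionInterior_of_subset (hF : F ∈ regionInterior R) (hFG : F ⊆ G)
    (hG : G ∈ regionFaces univ) : G ∈ regionInterior R :=
  ⟨fun a => (hF.1 a).imp fun _ hx => hFG hx, hG, fun c hc => hF.2.2 c (hFG.trans hc)⟩

theorem card_le_of_mem_regionInterior (hF : F ∈ regionInterior R) : Fintype.card ι ≤ F.card := by
  have himage : F.image Prod.fst = Finset.univ := Finset.eq_univ_iff_forall.2 fun a =>
    let ⟨x, hx⟩ := hF.1 a
    Finset.mem_image.2 ⟨(a, x), hx, rfl⟩
  rw [← Finset.card_univ, ← himage]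
  exact Finset.card_image_le

theorem subset_gridCell_update {r : ℤ} (hF : ∀ v ∈ F, v.1 ≠ a → v ∈ gridCell c)
    (ha : ∀ x, (a, x) ∈ F → x = r ∨ x = r + 1) : F ⊆ gridCell (Function.update c a r) := by
  rintro ⟨b, x⟩ hv
  rw [mem_gridCell]
  by_cases hb : b = a
  · subst hb
    simpa using ha x hv
  · simpa [hb] using mem_gridCell.1 (hF _ hv hb)

theorem exists_mem_of_mem_regionInterior {r : ℤ} (hr : ∀ c ∈ R, c a ≠ r)
    (hF : F ∈ regionInterior R) : ∃ x, (a, x) ∈ F ∧ x ≠ r ∧ x ≠ r + 1 := by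
  by_contra! h
  obtain ⟨c, -, hFc⟩ := regionInterior_subset R hF
  have hFu : F ⊆ gridCell (Function.update c a r) :=
    subset_gridCell_update (fun v hv _ => hFc hv) fun x hx => or_iff_not_imp_left.2 (h x hx)
  exact hr _ (hF.2.2 _ hFu) (Function.update_self ..)

theorem exists_gridCell_erase {v : ι × ℤ} (hv : v ∈ gridCell c) :
    ∃ c' ≠ c, (gridCell c).erase v ⊆ gridCell c' := by
  obtain ⟨a, x⟩ := v
  have hx : x = c a ∨ x = c a + 1 := mem_gridCell.1 hv
  refine ⟨Function.update c a (if x = c a then c a + 1 else c a - 1), fun h => ?_,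
    subset_gridCell_update (fun _ hv _ => Finset.mem_of_mem_erase hv) fun y hy => ?_⟩
  · have := congrFun h a
    rw [Function.update_self] at this
    split_ifs at this <;> omega
  · have hyx : y ≠ x := fun hyx => by simp [hyx] at hy
    have hy : y = c a ∨ y = c a + 1 := mem_gridCell.1 (Finset.mem_of_mem_erase hy)
    split_ifs <;> omega

theorem regionFaces_insert :
    regionFaces (insert c C) = regionFaces C ∪ Iic (gridCell c) := by
  ext F
  simp only [regionFaces, mem_insert_iff, exists_eq_or_imp, mem_union, mem_ofPred_eq, mem_Iic]
  exact or_comm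

theorem mem_regionInterior_of_insert (hF : F ∈ regionInterior (insert c C))
    (hFc : ¬ F ⊆ gridCell c) : F ∈ regionInterior C :=
  ⟨hF.1, hF.2.1, fun c' hc' => (hF.2.2 c' hc').resolve_left fun h => hFc (h ▸ hc')⟩

theorem regionInterior_insert (hS : S ⊆ gridCell c)
    (hC : ∀ F ⊆ gridCell c, F ∈ regionFaces C ↔ ¬ S ⊆ F)
    (hI : gridCell c \ S ∈ regionInterior (insert c C)) :
    regionInterior (insert c C) = regionInterior C ∪ Icc (gridCell c \ S) (gridCell c) := by
  refine Subset.antisymm (fun F hF => ?_) (union_subset (regionInterior_mono (subset_insert c C))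
    fun F hF => mem_regionInterior_of_subset hI hF.1 ⟨c, mem_univ c, hF.2⟩)
  by_cases hFc : F ⊆ gridCell c
  · refine .inr ⟨fun v hv => ?_, hFc⟩
    by_contra hvF
    rw [Finset.mem_sdiff] at hv
    obtain ⟨c', hc', hsub⟩ := exists_gridCell_erase hv.1
    have hc'C : c' ∈ C :=
      (hF.2.2 c' ((Finset.subset_erase.2 ⟨hFc, hvF⟩).trans hsub)).resolve_left hc'
    exact (hC _ (Finset.erase_subset v _)).1 ⟨c', hc'C, hsub⟩ (Finset.subset_erase.2 ⟨hS, hv.2⟩)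
  · exact .inl (mem_regionInterior_of_insert hF hFc)

theorem isShellableBall_empty :
    IsShellableBall (regionFaces univ) (regionFaces (∅ : Set (ι → ℤ))) (regionInterior ∅) := by
  have hfaces : regionFaces (∅ : Set (ι → ℤ)) = ∅ := by simp [regionFaces]
  rw [hfaces, subset_empty_iff.1 ((regionInterior_subset ∅).trans hfaces.subset)]
  exact .empty

theorem isShellableBall_insert [Nontrivial ι]
    (hball : IsShellableBall (regionFaces univ) (regionFaces C) (regionInterior C))
    (hS : S ⊆ gridCell c) (hC : ∀ F ⊆ gridCell c, F ∈ regionFaces C ↔ ¬ S ⊆ F)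
    (hI : gridCell c \ S ∈ regionInterior (insert c C)) :
    IsShellableBall (regionFaces univ) (regionFaces (insert c C))
      (regionInterior (insert c C)) := by
  rw [regionFaces_insert, regionInterior_insert hS hC hI]
  refine .add_facet hball ⟨c, mem_univ c, subset_rfl⟩ hS
    (Fintype.one_lt_card.trans_le (card_le_of_mem_regionInterior hI)) hC fun G hG hIG => ?_
  exact or_iff_not_imp_left.2
    (mem_regionInterior_of_insert (mem_regionInterior_of_subset hI hIG hG))

theorem notMem_of_mem_regionFaces (hR : ∀ c ∈ R, c a ≠ x ∧ c a ≠ x - 1) (hF : F ∈ regionFaces R) :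
    (a, x) ∉ F := fun hx => by
  obtain ⟨c, hc, hFc⟩ := hF
  have := hR c hc
  have : x = c a ∨ x = c a + 1 := mem_gridCell.1 (hFc hx)
  omega

theorem exists_notMem_of_notMem_regionInterior (hspan : ∀ a, ∃ x, (a, x) ∈ F)
    (hF : F ∈ regionFaces univ) (hFR : F ∉ regionInterior R) : ∃ c ∉ R, F ⊆ gridCell c := by
  by_contra! h
  exact hFR ⟨hspan, hF, fun c hc => by_contra fun hcR => h c hcR hc⟩

section Extension

variable {r r' : ℤ}

theorem exists_mem_erase_of_mem_regionInterior (hr : r = x - 1 ∨ r = x)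
    (hR' : ∀ c ∈ R', (a, x) ∈ gridCell c → c a = r) (hF : F ∈ regionInterior R') (b : ι) :
    ∃ y, (b, y) ∈ F.erase (a, x) := by
  by_contra! h
  obtain ⟨y, hy⟩ := hF.1 b
  obtain ⟨rfl, rfl⟩ : b = a ∧ y = x :=
    Prod.mk.inj (by_contra fun hne => h y (Finset.mem_erase.2 ⟨hne, hy⟩))
  obtain ⟨c, -, hFc⟩ := regionInterior_subset R' hF
  have hFu : F ⊆ gridCell (Function.update c b (2 * y - 1 - r)) := by
    refine subset_gridCell_update (fun v hv _ => hFc hv) fun z hz => ?_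
    obtain rfl : z = y := by_contra fun hzy => h z (by simp [hz, hzy])
    omega
  have := hR' _ (hF.2.2 _ hFu) (hFu hy)
  rw [Function.update_self] at this
  omega

theorem apply_eq_of_erase_subset (hr : (r = x - 1 ∧ r' = x - 2) ∨ (r = x ∧ r' = x + 1))
    (hR' : ∀ c ∈ R', (a, x) ∈ gridCell c → c a = r) (hnew : ∀ c ∈ R', c ∉ R → c a = r)
    (hbelow : ∀ c ∈ R', c a = r → Function.update c a r' ∈ R) (hF : F ∈ regionInterior R')
    (hcR : c ∉ R) (hFc : F.erase (a, x) ⊆ gridCell c) : c a = r := by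
  by_cases hxF : (a, x) ∈ F
  · obtain ⟨y, hy⟩ := exists_mem_erase_of_mem_regionInterior (by omega) hR' hF a
    have hyx : y ≠ x := fun hyx => by simp [hyx] at hy
    have hyc : y = c a ∨ y = c a + 1 := mem_gridCell.1 (hFc hy)
    obtain ⟨c', hc', hFc'⟩ := regionInterior_subset R' hF
    have hc'a : c' a = r := hR' c' hc' (hFc' hxF)
    have hmem : ∀ z, (a, z) ∈ F → z = r ∨ z = r + 1 := fun z hz => hc'a ▸ mem_gridCell.1 (hFc' hz)
    have hyr := hmem y (Finset.mem_of_mem_erase hy)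
    by_contra hca
    obtain rfl : c a = r' := by omega
    have hFu : F ⊆ gridCell (Function.update c a r) := subset_gridCell_update
      (fun v hv hva => hFc (Finset.mem_erase.2 ⟨fun h => hva (h ▸ rfl), hv⟩)) hmem
    have hcR' := hbelow _ (hF.2.2 _ hFu) (Function.update_self ..)
    rw [Function.update_idem, Function.update_eq_self] at hcR'
    exact hcR hcR'
  · rw [Finset.erase_eq_of_notMem hxF] at hFc
    exact hnew c (hF.2.2 c hFc) hcR

theorem isExtension_region (hr : (r = x - 1 ∧ r' = x - 2) ∨ (r = x ∧ r' = x + 1))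
    (hR : ∀ c ∈ R, c a ≠ x ∧ c a ≠ x - 1) (hmono : R ⊆ R') (hne : ∃ c ∈ R', c a = r)
    (hnew : ∀ c ∈ R', c ∉ R → c a = r) (hbelow : ∀ c ∈ R', c a = r → Function.update c a r' ∈ R) :
    IsExtension (regionFaces R) (regionInterior R) (a, x) (regionFaces R') (regionInterior R') := by
  have hxr : ∀ {c}, c a = r → (a, x) ∈ gridCell c := fun {c} hc => mem_gridCell.2 (by grind)
  have hxR' : ∀ c ∈ R', (a, x) ∈ gridCell c → c a = r := fun c hc hx =>
    hnew c hc fun hcR => notMem_of_mem_regionFaces hR ⟨c, hcR, subset_rfl⟩ hx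
  refine ⟨fun F hF => notMem_of_mem_regionFaces hR hF, regionFaces_mono hmono, ?_,
    fun F ⟨c, hc, hFc⟩ => ?_, fun F ⟨c, _, hFc⟩ hxF hF => ?_, fun F hF T hT hTR hFT => ?_⟩
  · obtain ⟨c, hc, hca⟩ := hne
    exact ⟨c, hc, Finset.singleton_subset_iff.2 (hxr hca)⟩
  · by_cases hcR : c ∈ R
    · exact ⟨c, hcR, (Finset.erase_subset _ _).trans hFc⟩
    · have hca := hnew c hc hcR
      refine ⟨_, hbelow c hc hca, subset_gridCell_update
        (fun v hv _ => hFc (Finset.mem_of_mem_erase hv)) fun y hy => ?_⟩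
      have hyx : y ≠ x := fun hyx => by simp [hyx] at hy
      have hy : y = c a ∨ y = c a + 1 := mem_gridCell.1 (hFc (Finset.mem_of_mem_erase hy))
      omega
  · have hcR : c ∈ R := hF.2.2 c ((Finset.erase_subset _ _).trans hFc)
    exact notMem_of_mem_regionFaces hR ⟨c, hcR, subset_rfl⟩ (hFc hxF)
  · obtain ⟨c, hcR, hTc⟩ := exists_notMem_of_notMem_regionInterior
      (fun b => (exists_mem_erase_of_mem_regionInterior (by omega) hxR' hF b).imp
        fun _ hy => hFT hy) (regionFaces_mono (subset_univ R) hT) hTR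
    have hca := apply_eq_of_erase_subset hr hxR' hnew hbelow hF hcR (hFT.trans hTc)
    have hinsert := Finset.insert_subset (hxr hca) hTc
    exact ⟨c, hF.2.2 c ((Finset.subset_insert_iff.2 hFT).trans hinsert), hinsert⟩

end Extension

end Grid

section OrderIdeals

variable {ι : Type*} {R R' C : Set (ι → ℤ)} {b c : ι → ℤ}

/-- `R` is an order ideal in the orthant of all `c ≥ b`. -/
def IsIdealAbove (b : ι → ℤ) (R : Set (ι → ℤ)) : Prop := ∀ c ∈ R, b ≤ c ∧ Icc b c ⊆ R

theorem IsIdealAbove.diff_singleton_of_maximal (hR : IsIdealAbove b R) (hc : Maximal (· ∈ R) c) :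
    IsIdealAbove b (R \ {c}) := fun d hd =>
  ⟨(hR d hd.1).1, fun _ he => ⟨(hR d hd.1).2 he, fun hec =>
    hd.2 ((hc.eq_of_le hd.1 (mem_singleton_iff.1 hec ▸ he.2)).symm)⟩⟩

variable [Fintype ι] [DecidableEq ι]

namespace IsIdealAbove

theorem mem_regionFaces_iff_not_subset (hC : IsIdealAbove b C)
    (hinsert : IsIdealAbove b (insert c C)) (hcC : c ∉ C) {F S : Finset (ι × ℤ)}
    (hS : ∀ v, v ∈ S ↔ v.2 = c v.1 + 1 ∧ b v.1 < c v.1) (hF : F ⊆ gridCell c) :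
    F ∈ regionFaces C ↔ ¬ S ⊆ F := by
  obtain ⟨hbc, hIcc⟩ := hinsert c (mem_insert c C)
  constructor
  · rintro ⟨c', hc', hFc'⟩ hSF
    refine hcC ((hC c' hc').2 ⟨hbc, fun a => ?_⟩)
    rcases (hbc a).lt_or_eq with ha | ha
    · have hup : c a + 1 = c' a ∨ c a + 1 = c' a + 1 :=
        mem_gridCell.1 (hFc' (hSF ((hS (a, c a + 1)).2 ⟨rfl, ha⟩)))
      change c a ≤ c' a
      omega
    · exact ha ▸ (hC c' hc').1 a
  · intro hSF
    obtain ⟨⟨a, x⟩, hx, hxF⟩ := Finset.not_subset.1 hSF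
    obtain ⟨rfl, ha⟩ : x = c a + 1 ∧ b a < c a := (hS _).1 hx
    refine ⟨Function.update c a (c a - 1), (hIcc ⟨?_, ?_⟩).resolve_left fun h => ?_,
      subset_gridCell_update (fun v hv _ => hF hv) fun y hy => ?_⟩
    · exact le_update_iff.2 ⟨by omega, fun i _ => hbc i⟩
    · exact update_le_iff.2 ⟨by omega, fun _ _ => le_rfl⟩
    · have := congrFun h a
      rw [Function.update_self] at this
      omega
    · have hne : y ≠ c a + 1 := fun h => hxF (h ▸ hy)
      have hy : y = c a ∨ y = c a + 1 := mem_gridCell.1 (hF hy)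
      omega

theorem isShellableBall_insert [Nontrivial ι] (hC : IsIdealAbove b C)
    (hinsert : IsIdealAbove b (insert c C)) (hcC : c ∉ C)
    (hball : IsShellableBall (regionFaces univ) (regionFaces C) (regionInterior C)) :
    IsShellableBall (regionFaces univ) (regionFaces (insert c C))
      (regionInterior (insert c C)) := by
  obtain ⟨hbc, hIcc⟩ := hinsert c (mem_insert c C)
  obtain ⟨S, hS⟩ : ∃ S : Finset (ι × ℤ), ∀ v, v ∈ S ↔ v.2 = c v.1 + 1 ∧ b v.1 < c v.1 := by
    classical
    refine ⟨{v ∈ gridCell c | v.2 = c v.1 + 1 ∧ b v.1 < c v.1}, fun v => ?_⟩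
    rw [Finset.mem_filter, mem_gridCell]
    tauto
  have hmem : ∀ a, (a, c a) ∈ gridCell c \ S := fun a => by simp [hS, mem_gridCell]
  refine _root_.isShellableBall_insert hball (fun v hv => mem_gridCell.2 (.inr ((hS v).1 hv).1))
    (fun F hF => hC.mem_regionFaces_iff_not_subset hinsert hcC hS hF)
    ⟨fun a => ⟨c a, hmem a⟩, ⟨c, mem_univ c, Finset.sdiff_subset⟩, fun c' hc' => ?_⟩
  have hlow : ∀ a, c a = c' a ∨ c a = c' a + 1 := fun a => mem_gridCell.1 (hc' (hmem a))
  have hup : ∀ a, b a = c a → c a + 1 = c' a ∨ c a + 1 = c' a + 1 := fun a ha =>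
    mem_gridCell.1 (hc' (show (a, c a + 1) ∈ gridCell c \ S by simp [hS, mem_gridCell, ha]))
  exact hIcc ⟨fun a => show b a ≤ c' a by grind [hbc a], fun a => show c' a ≤ c a by grind⟩

theorem isShellableBall [Nontrivial ι] (hR : IsIdealAbove b R) (hfin : R.Finite) :
    IsShellableBall (regionFaces univ) (regionFaces R) (regionInterior R) := by
  induction hn : R.ncard generalizing R with
  | zero =>
    rw [(ncard_eq_zero hfin).1 hn]
    exact isShellableBall_empty
  | succ n ih =>
    obtain ⟨c, hc⟩ := hfin.exists_maximal (nonempty_of_ncard_ne_zero (by omega))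
    have hball := ih (hR.diff_singleton_of_maximal hc) hfin.sdiff
      (by rw [ncard_sdiff_singleton_of_mem hc.prop, hn, Nat.add_sub_cancel])
    have hinsert : insert c (R \ {c}) = R := insert_sdiff_self_of_mem hc.prop
    rw [← hinsert]
    exact (hR.diff_singleton_of_maximal hc).isShellableBall_insert (by rwa [hinsert])
      (by simp) hball

theorem insert_pair_mem_regionFaces (hR : IsIdealAbove b R) {p : ℤ} {z : ι × ℤ} {a : ι}
    (hp : {(a, p), (a, p + 1)} ∈ regionFaces R) (hpz : {(a, p), z} ∈ regionFaces R)
    (hqz : {(a, p + 1), z} ∈ regionFaces R) : {(a, p), (a, p + 1), z} ∈ regionFaces R := by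
  obtain ⟨c₀, hc₀, hp⟩ := hp
  obtain ⟨c₁, -, hpz⟩ := hpz
  obtain ⟨c, hc, hqz⟩ := hqz
  simp only [Finset.insert_subset_iff, Finset.singleton_subset_iff, mem_gridCell] at hp hpz hqz
  have hbp : b a ≤ c₀ a := (hR c₀ hc₀).1 a
  refine ⟨Function.update c a p, (hR c hc).2 ⟨?_, ?_⟩, ?_⟩
  · exact le_update_iff.2 ⟨by omega, fun i _ => (hR c hc).1 i⟩
  · exact update_le_iff.2 ⟨by omega, fun _ _ => le_rfl⟩
  · simp only [Finset.insert_subset_iff, Finset.singleton_subset_iff, mem_gridCell]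
    obtain ⟨i, r⟩ := z
    by_cases hi : i = a
    · subst hi
      simp only [Function.update_self, true_or, or_true, true_and] at hpz hqz ⊢
      omega
    · simpa [hi] using hqz.2

theorem mem_regionFaces_of_card_eq_three (hR : IsIdealAbove b R) (hι : Fintype.card ι = 2)
    {T : Finset (ι × ℤ)} (hT : T.card = 3) (hG : ∀ G ⊂ T, G ∈ regionFaces R) :
    T ∈ regionFaces R := by
  obtain ⟨⟨a, p⟩, hu, ⟨a', q⟩, hv, huv, rfl : a = a'⟩ :=
    Finset.exists_ne_map_eq_of_card_lt_of_maps_to (t := Finset.univ) (f := Prod.fst)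
      (show Finset.univ.card < T.card by rw [Finset.card_univ, hι, hT]; norm_num)
      fun v _ => Finset.mem_univ v.1
  have hpq : p ≠ q := fun h => huv (by rw [h])
  wlog hlt : p < q generalizing p q
  · exact this q hv p hu huv.symm hpq.symm (by omega)
  obtain ⟨z, hz, hzuv⟩ : ∃ z ∈ T, z ∉ ({(a, p), (a, q)} : Finset (ι × ℤ)) :=
    Finset.exists_mem_notMem_of_card_lt_card (by rw [Finset.card_pair huv, hT]; norm_num)
  simp only [Finset.mem_insert, Finset.mem_singleton, not_or] at hzuv
  have hpair : ∀ u ∈ T, ∀ v ∈ T, {u, v} ∈ regionFaces R := fun u hu v hv =>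
    hG _ (Finset.ssubset_iff_subset_ne.2 ⟨by simp [Finset.insert_subset_iff, hu, hv], fun h => by
      simpa [h, hT] using Finset.card_le_two (a := u) (b := v)⟩)
  obtain ⟨c, -, hc⟩ := hpair _ hu _ hv
  simp only [Finset.insert_subset_iff, Finset.singleton_subset_iff, mem_gridCell] at hc
  obtain rfl : q = p + 1 := by omega
  rw [← Finset.eq_of_subset_of_card_le (s := {(a, p), (a, p + 1), z}) (t := T)
    (by simp [Finset.insert_subset_iff, hu, hv, hz])
    (by rw [hT, Finset.card_eq_three.2 ⟨_, _, _, huv, Ne.symm hzuv.1, Ne.symm hzuv.2, rfl⟩])]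
  exact hR.insert_pair_mem_regionFaces (hpair _ hu _ hv) (hpair _ hu _ hz) (hpair _ hv _ hz)

end IsIdealAbove

section Extension

variable {n m : ℕ} {a : ι} {x : ℤ}

theorem IsConeSphere.hasConeSphere_of_isExtension {K : Set (Finset (ι × ℤ))}
    {X : Finset (ι × ℤ)} (hι : Fintype.card ι = 2)
    (h : IsConeSphere K X (a, x) (regionFaces R) (regionInterior R) n m) (hR : IsIdealAbove b R)
    (hfin : R.Finite)
    (hext : IsExtension (regionFaces R) (regionInterior R) (a, x) (regionFaces R')
      (regionInterior R')) :
    HasConeSphere (regionFaces R') (regionInterior R') (n + 1)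
      (m + (minimalFaces (regionInterior R) 3).ncard) := fun w' hw' => by
  have : Nontrivial ι := Fintype.one_lt_card_iff_nontrivial.1 (by omega)
  exact ⟨_, _, h.replaceByCone (isLowerSet_regionFaces univ) (hR.isShellableBall hfin)
    (fun _ => hR.mem_regionFaces_of_card_eq_three hι)
    (fun F hF => hι ▸ card_le_of_mem_regionInterior hF) hext (regionInterior_subset R') hw'⟩

theorem HasConeSphere.extend (hι : Fintype.card ι = 2)
    (h : HasConeSphere (regionFaces R) (regionInterior R) n m) (hR : IsIdealAbove b R)
    (hfin : R.Finite)
    (hext : IsExtension (regionFaces R) (regionInterior R) (a, x) (regionFaces R')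
      (regionInterior R')) :
    HasConeSphere (regionFaces R') (regionInterior R') (n + 1)
      (m + (minimalFaces (regionInterior R) 3).ncard) :=
  have ⟨_, _, hK⟩ := h (a, x) hext.notMem
  hK.hasConeSphere_of_isExtension hι hR hfin hext

end Extension

end OrderIdeals

section InteriorTriangles

variable {R : Set (Fin 2 → ℤ)} {a b : Fin 2} {x y : ℤ} {T : Finset (Fin 2 × ℤ)}

theorem pair_mem_regionInterior_iff (hab : a ≠ b) :
    {(a, x), (b, y)} ∈ regionInterior R ↔
      ∀ c, (x = c a ∨ x = c a + 1) → (y = c b ∨ y = c b + 1) → c ∈ R := by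
  have hspan : ∀ i, ∃ z, (i, z) ∈ ({(a, x), (b, y)} : Finset (Fin 2 × ℤ)) := fun i => by
    obtain rfl | rfl : i = a ∨ i = b := by omega
    exacts [⟨x, by simp⟩, ⟨y, by simp⟩]
  have hface : {(a, x), (b, y)} ∈ regionFaces (univ : Set (Fin 2 → ℤ)) :=
    ⟨Function.update (fun _ => x) b y, mem_univ _,
      by simp [Finset.insert_subset_iff, mem_gridCell, hab]⟩
  refine (and_iff_right hspan).trans ((and_iff_right hface).trans (forall_congr' fun c => ?_))
  simp only [Finset.insert_subset_iff, Finset.singleton_subset_iff, mem_gridCell, and_imp]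

/-- The triangle with an edge `{x, x + 1}` on the line `a` and a vertex `y` on the line `b`. -/
def gridTriangle (a b : Fin 2) (x y : ℤ) : Finset (Fin 2 × ℤ) := {(a, x), (a, x + 1), (b, y)}

theorem card_gridTriangle (hab : a ≠ b) : (gridTriangle a b x y).card = 3 :=
  Finset.card_eq_three.2 ⟨_, _, _, by simp, by simp [hab], by simp [hab], rfl⟩

theorem gridTriangle_mem_regionInterior_iff (hab : a ≠ b) :
    gridTriangle a b x y ∈ regionInterior R ↔
      ∀ c, x = c a → (y = c b ∨ y = c b + 1) → c ∈ R := by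
  have hspan : ∀ i, ∃ z, (i, z) ∈ gridTriangle a b x y := fun i => by
    obtain rfl | rfl : i = a ∨ i = b := by omega
    exacts [⟨x, by simp [gridTriangle]⟩, ⟨y, by simp [gridTriangle]⟩]
  have hface : gridTriangle a b x y ∈ regionFaces univ :=
    ⟨Function.update (fun _ => x) b y, mem_univ _,
      by simp [gridTriangle, Finset.insert_subset_iff, mem_gridCell, hab]⟩
  refine (and_iff_right hspan).trans ((and_iff_right hface).trans (forall_congr' fun c => ?_))
  simp only [gridTriangle, Finset.insert_subset_iff, Finset.singleton_subset_iff, mem_gridCell]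
  grind

theorem gridTriangle_mem_minimalFaces_iff (hab : a ≠ b) :
    gridTriangle a b x y ∈ minimalFaces (regionInterior R) 3 ↔
      gridTriangle a b x y ∈ regionInterior R ∧
        {(a, x), (b, y)} ∉ regionInterior R ∧ {(a, x + 1), (b, y)} ∉ regionInterior R := by
  constructor
  · rintro ⟨hT, -⟩
    refine ⟨hT.prop, fun h => ?_, fun h => ?_⟩
    · have hle := hT.le_of_le h (by simp [gridTriangle, Finset.insert_subset_iff])
      simp [gridTriangle, Finset.insert_subset_iff, hab] at hle
    · have hle := hT.le_of_le h (by simp [gridTriangle])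
      simp [gridTriangle, Finset.insert_subset_iff, hab] at hle
  · rintro ⟨hT, hx, hx'⟩
    refine ⟨⟨hT, fun G hG hGT => ?_⟩, card_gridTriangle hab⟩
    have hface {e : Finset (Fin 2 × ℤ)} (he : e ⊆ gridTriangle a b x y) (hGe : G ⊆ e) :
        e ∈ regionInterior R :=
      mem_regionInterior_of_subset hG hGe (isLowerSet_regionFaces univ he hT.2.1)
    obtain ⟨z, hz⟩ := hG.1 b
    have hzy : z = y := by simpa [gridTriangle, hab.symm] using hGT hz
    have hxG : (a, x) ∈ G := by_contra fun hxG => hx' <|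
      hface (by simp [gridTriangle]) ((Finset.subset_insert_iff_of_notMem hxG).1 hGT)
    have hxG' : (a, x + 1) ∈ G := by_contra fun hxG' => hx <|
      hface (by simp [gridTriangle, Finset.insert_subset_iff])
        ((Finset.subset_insert_iff_of_notMem hxG').1 (by rwa [Finset.insert_comm]))
    exact Finset.insert_subset hxG
      (Finset.insert_subset hxG' (Finset.singleton_subset_iff.2 (hzy ▸ hz)))

theorem exists_eq_gridTriangle (hT : T ∈ regionInterior R) (hcard : T.card = 3) :
    ∃ a b, a ≠ b ∧ ∃ x y, T = gridTriangle a b x y := by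
  obtain ⟨⟨a, p⟩, hu, ⟨a', q⟩, hv, huv, rfl : a = a'⟩ :=
    Finset.exists_ne_map_eq_of_card_lt_of_maps_to (t := Finset.univ) (f := Prod.fst)
      (show Finset.univ.card < T.card by rw [hcard]; decide) fun v _ => Finset.mem_univ v.1
  obtain ⟨c, -, hc⟩ := hT.2.1
  have hpq : p ≠ q := fun h => huv (by rw [h])
  have hp : p = c a ∨ p = c a + 1 := mem_gridCell.1 (hc hu)
  have hq : q = c a ∨ q = c a + 1 := mem_gridCell.1 (hc hv)
  obtain ⟨b, hab⟩ := exists_ne a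
  obtain ⟨y, hy⟩ := hT.1 b
  refine ⟨a, b, hab.symm, c a, y, (Finset.eq_of_subset_of_card_le ?_ ?_).symm⟩
  · have hmem : (a, c a) ∈ T ∧ (a, c a + 1) ∈ T := by
      rcases hp with rfl | rfl <;> rcases hq with rfl | rfl <;> simp_all
    exact Finset.insert_subset hmem.1
      (Finset.insert_subset hmem.2 (Finset.singleton_subset_iff.2 hy))
  · rw [hcard, card_gridTriangle hab.symm]

theorem gridTriangle_injective (hab : a ≠ b) : Function.Injective (gridTriangle a b x) :=
  fun y z hyz => by
    have hy : (b, y) ∈ gridTriangle a b x z := hyz ▸ by simp [gridTriangle]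
    simpa [gridTriangle, hab.symm] using hy

end InteriorTriangles

section Staircases

variable {x₀ y₀ t s x y : ℤ}

/-- A rectangle of cells with left column `x₀`, right column `0`, lowest row `y₀` and highest row
`t - 1`, followed by a column `1` with highest row `s - 1`. -/
def staircase (x₀ y₀ t s : ℤ) : Set (Fin 2 → ℤ) :=
  {c | x₀ ≤ c 0 ∧ y₀ ≤ c 1 ∧ (c 0 ≤ 0 ∧ c 1 < t ∨ c 0 = 1 ∧ c 1 < s)}

theorem vec_mem_staircase : ![x, y] ∈ staircase x₀ y₀ t s ↔
    x₀ ≤ x ∧ y₀ ≤ y ∧ (x ≤ 0 ∧ y < t ∨ x = 1 ∧ y < s) :=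
  Iff.rfl

theorem isIdealAbove_staircase (hst : s ≤ t) : IsIdealAbove ![x₀, y₀] (staircase x₀ y₀ t s) := by
  refine fun c ⟨hx, hy, hc⟩ => ⟨Fin.forall_fin_two.2 ⟨hx, hy⟩, fun d ⟨hd, hdc⟩ => ?_⟩
  have hdc₀ : d 0 ≤ c 0 := hdc 0
  have hdc₁ : d 1 ≤ c 1 := hdc 1
  exact ⟨hd 0, hd 1, by omega⟩

theorem finite_staircase (x₀ y₀ t s : ℤ) : (staircase x₀ y₀ t s).Finite := by
  refine (finite_Icc ![x₀, y₀] ![1, max t s]).subset fun c ⟨hx, hy, hc⟩ =>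
    ⟨Fin.forall_fin_two.2 ⟨hx, hy⟩, Fin.forall_fin_two.2 ⟨?_, ?_⟩⟩
  · change c 0 ≤ 1
    omega
  · change c 1 ≤ max t s
    omega

theorem pair_mem_regionInterior_staircase_iff (hst : s ≤ t) :
    {(0, x), (1, y)} ∈ regionInterior (staircase x₀ y₀ t s) ↔
      x₀ < x ∧ y₀ < y ∧ (x ≤ 0 ∧ y < t ∨ x = 1 ∧ y < s) := by
  rw [pair_mem_regionInterior_iff (by decide)]
  refine ⟨fun h => ?_, fun h c hx hy => ⟨by omega, by omega, by omega⟩⟩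
  obtain ⟨hx, hy, -⟩ : x₀ ≤ x - 1 ∧ y₀ ≤ y - 1 ∧ _ := h ![x - 1, y - 1] (by simp) (by simp)
  obtain ⟨-, -, htop⟩ : _ ∧ _ ∧ (x ≤ 0 ∧ y < t ∨ x = 1 ∧ y < s) := h ![x, y] (by simp) (by simp)
  exact ⟨by omega, by omega, htop⟩

theorem gridTriangle_zero_one_mem_regionInterior_staircase_iff :
    gridTriangle 0 1 x y ∈ regionInterior (staircase x₀ y₀ t s) ↔
      x₀ ≤ x ∧ y₀ < y ∧ (x ≤ 0 ∧ y < t ∨ x = 1 ∧ y < s) := by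
  rw [gridTriangle_mem_regionInterior_iff (by decide)]
  refine ⟨fun h => ?_, fun h c hx hy => ⟨by omega, by omega, by omega⟩⟩
  obtain ⟨-, hy, -⟩ : _ ∧ y₀ ≤ y - 1 ∧ _ := h ![x, y - 1] rfl (by simp)
  obtain ⟨hx, -, htop⟩ : x₀ ≤ x ∧ _ ∧ (x ≤ 0 ∧ y < t ∨ x = 1 ∧ y < s) := h ![x, y] rfl (by simp)
  exact ⟨hx, by omega, htop⟩

theorem gridTriangle_one_zero_mem_regionInterior_staircase_iff (hst : s ≤ t) :
    gridTriangle 1 0 y x ∈ regionInterior (staircase x₀ y₀ t s) ↔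
      x₀ < x ∧ y₀ ≤ y ∧ (x ≤ 0 ∧ y < t ∨ x = 1 ∧ y < s) := by
  rw [gridTriangle_mem_regionInterior_iff (by decide)]
  refine ⟨fun h => ?_, fun h c hx hy => ⟨by omega, by omega, by omega⟩⟩
  obtain ⟨hx, -, -⟩ : x₀ ≤ x - 1 ∧ _ ∧ _ := h ![x - 1, y] rfl (by simp)
  obtain ⟨-, hy, htop⟩ : _ ∧ y₀ ≤ y ∧ (x ≤ 0 ∧ y < t ∨ x = 1 ∧ y < s) := h ![x, y] rfl (by simp)
  exact ⟨by omega, hy, htop⟩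

theorem minimalFaces_staircase (hx₀ : x₀ ≤ 0) (ht : y₀ + 2 ≤ t) (hst : s ≤ t)
    (hs : s = y₀ ∨ y₀ + 2 ≤ s) :
    minimalFaces (regionInterior (staircase x₀ y₀ t s)) 3 =
      {T | x₀ = 0 ∧ ∃ y, y₀ < y ∧ s ≤ y ∧ y < t ∧ T = gridTriangle 0 1 0 y} := by
  have hpair : ∀ x y, {(1, y), (0, x)} ∈ regionInterior (staircase x₀ y₀ t s) ↔ _ := fun x y => by
    rw [Finset.pair_comm, pair_mem_regionInterior_staircase_iff hst]
  ext T
  constructor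
  · intro hT
    obtain ⟨a, b, hab, x, y, rfl⟩ := exists_eq_gridTriangle hT.1.prop hT.2
    rw [gridTriangle_mem_minimalFaces_iff hab] at hT
    obtain ⟨rfl, rfl⟩ | ⟨rfl, rfl⟩ : (a = 0 ∧ b = 1) ∨ (a = 1 ∧ b = 0) := by omega
    · simp only [gridTriangle_zero_one_mem_regionInterior_staircase_iff,
        pair_mem_regionInterior_staircase_iff hst] at hT
      obtain rfl : x = 0 := by omega
      exact ⟨by omega, y, by omega, by omega, by omega, rfl⟩
    · simp only [gridTriangle_one_zero_mem_regionInterior_staircase_iff hst, hpair] at hT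
      omega
  · rintro ⟨rfl, y, hy, hsy, hyt, rfl⟩
    simp only [gridTriangle_mem_minimalFaces_iff (show (0 : Fin 2) ≠ 1 by decide),
      gridTriangle_zero_one_mem_regionInterior_staircase_iff,
      pair_mem_regionInterior_staircase_iff hst]
    omega

theorem ncard_minimalFaces_staircase_of_neg (hx₀ : x₀ < 0) (ht : y₀ + 2 ≤ t) (hst : s ≤ t)
    (hs : s = y₀ ∨ y₀ + 2 ≤ s) :
    (minimalFaces (regionInterior (staircase x₀ y₀ t s)) 3).ncard = 0 := by
  simp [minimalFaces_staircase hx₀.le ht hst hs, hx₀.ne]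

theorem ncard_minimalFaces_staircase_zero (ht : y₀ + 2 ≤ t) (hst : s ≤ t)
    (hs : s = y₀ ∨ y₀ + 2 ≤ s) :
    (minimalFaces (regionInterior (staircase 0 y₀ t s)) 3).ncard =
      (t - max s (y₀ + 1)).toNat := by
  have himage : minimalFaces (regionInterior (staircase 0 y₀ t s)) 3 =
      gridTriangle 0 1 0 '' Ico (max s (y₀ + 1)) t := by
    rw [minimalFaces_staircase le_rfl ht hst hs]
    ext T
    simp only [mem_ofPred_eq, mem_image, mem_Ico, max_le_iff, true_and]
    exact exists_congr fun y => by grind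
  rw [himage, ncard_image_of_injective _ (gridTriangle_injective (by decide)),
    ← Finset.coe_Ico, ncard_coe_finset, Int.card_Ico]

end Staircases

section StaircaseSpheres

variable {x₀ y₀ t s : ℤ} {n m : ℕ}

/-- Cone spheres over the ball given by a staircase exist for every choice of the apex. -/
def HasStaircaseSphere (x₀ y₀ t s : ℤ) (n m : ℕ) : Prop :=
  HasConeSphere (regionFaces (staircase x₀ y₀ t s)) (regionInterior (staircase x₀ y₀ t s)) n m

theorem isExtension_staircase_top (hx₀ : x₀ ≤ 0) (ht : y₀ < t) (hst : s ≤ t) :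
    IsExtension (regionFaces (staircase x₀ y₀ t s)) (regionInterior (staircase x₀ y₀ t s))
      (1, t + 1) (regionFaces (staircase x₀ y₀ (t + 1) s))
      (regionInterior (staircase x₀ y₀ (t + 1) s)) := by
  refine isExtension_region (r := t) (r' := t - 1) (by omega) ?_ ?_
    ⟨![0, t], vec_mem_staircase.2 (by omega), rfl⟩ ?_ ?_ <;>
    grind [staircase]

theorem isExtension_staircase_bottom (hx₀ : x₀ ≤ 0) (ht : y₀ < t) (hs : y₀ < s) :
    IsExtension (regionFaces (staircase x₀ y₀ t s)) (regionInterior (staircase x₀ y₀ t s))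
      (1, y₀ - 1) (regionFaces (staircase x₀ (y₀ - 1) t s))
      (regionInterior (staircase x₀ (y₀ - 1) t s)) := by
  refine isExtension_region (r := y₀ - 1) (r' := y₀) (by omega) ?_ ?_
    ⟨![0, y₀ - 1], vec_mem_staircase.2 (by omega), rfl⟩ ?_ ?_ <;>
    grind [staircase]

theorem isExtension_staircase_left (hx₀ : x₀ ≤ 0) (ht : y₀ < t) :
    IsExtension (regionFaces (staircase x₀ y₀ t s)) (regionInterior (staircase x₀ y₀ t s))
      (0, x₀ - 1) (regionFaces (staircase (x₀ - 1) y₀ t s))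
      (regionInterior (staircase (x₀ - 1) y₀ t s)) := by
  refine isExtension_region (r := x₀ - 1) (r' := x₀) (by omega) ?_ ?_
    ⟨![x₀ - 1, y₀], vec_mem_staircase.2 (by omega), rfl⟩ ?_ ?_ <;>
    grind [staircase]

theorem isExtension_staircase_right (hx₀ : x₀ ≤ 0) (hs : y₀ < s) (hst : s ≤ t) :
    IsExtension (regionFaces (staircase x₀ y₀ t y₀)) (regionInterior (staircase x₀ y₀ t y₀))
      (0, 2) (regionFaces (staircase x₀ y₀ t s)) (regionInterior (staircase x₀ y₀ t s)) := by
  refine isExtension_region (r := 1) (r' := 0) (by omega) ?_ ?_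
    ⟨![1, y₀], vec_mem_staircase.2 (by omega), rfl⟩ ?_ ?_ <;>
    grind [staircase]

namespace HasStaircaseSphere

variable {x₁ y₁ t₁ s₁ : ℤ} {v : Fin 2 × ℤ}

theorem extend_of_neg (h : HasStaircaseSphere x₀ y₀ t s n m) (hx₀ : x₀ < 0) (ht : y₀ + 2 ≤ t)
    (hst : s ≤ t) (hs : s = y₀ ∨ y₀ + 2 ≤ s)
    (hext : IsExtension (regionFaces (staircase x₀ y₀ t s)) (regionInterior (staircase x₀ y₀ t s))
      v (regionFaces (staircase x₁ y₁ t₁ s₁)) (regionInterior (staircase x₁ y₁ t₁ s₁))) :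
    HasStaircaseSphere x₁ y₁ t₁ s₁ (n + 1) m := by
  have := h.extend rfl (isIdealAbove_staircase hst) (finite_staircase ..) hext
  rwa [ncard_minimalFaces_staircase_of_neg hx₀ ht hst hs, Nat.add_zero] at this

theorem extend_of_zero (h : HasStaircaseSphere 0 y₀ t s n m) (ht : y₀ + 2 ≤ t) (hst : s ≤ t)
    (hs : s = y₀ ∨ y₀ + 2 ≤ s)
    (hext : IsExtension (regionFaces (staircase 0 y₀ t s)) (regionInterior (staircase 0 y₀ t s))
      v (regionFaces (staircase x₁ y₁ t₁ s₁)) (regionInterior (staircase x₁ y₁ t₁ s₁))) :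
    HasStaircaseSphere x₁ y₁ t₁ s₁ (n + 1) (m + (t - max s (y₀ + 1)).toNat) := by
  have := h.extend rfl (isIdealAbove_staircase hst) (finite_staircase ..) hext
  rwa [ncard_minimalFaces_staircase_zero ht hst hs] at this

theorem extend_left_iterate (h : HasStaircaseSphere x₀ y₀ t s n m) (hx₀ : x₀ < 0)
    (ht : y₀ + 2 ≤ t) (hst : s ≤ t) (hs : s = y₀ ∨ y₀ + 2 ≤ s) (j : ℕ) :
    HasStaircaseSphere (x₀ - j) y₀ t s (n + j) m := by
  induction j with
  | zero => simpa using h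
  | succ j ih =>
    rw [Nat.cast_add_one, ← sub_sub]
    exact ih.extend_of_neg (by omega) ht hst hs (isExtension_staircase_left (by omega) (by omega))

end HasStaircaseSphere

/-- A cone sphere with `n` vertices and `m` missing tetrahedra exists. -/
def ExistsConeSphere (n m : ℕ) : Prop :=
  ∃ (K : Set (Finset (Fin 2 × ℤ))) (X : Finset (Fin 2 × ℤ)) (w : Fin 2 × ℤ)
    (B I : Set (Finset (Fin 2 × ℤ))), IsConeSphere K X w B I n m

theorem HasStaircaseSphere.existsConeSphere (h : HasStaircaseSphere x₀ y₀ t s n m) :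
    ExistsConeSphere n m := by
  have hw : ∀ F ∈ regionFaces (staircase x₀ y₀ t s), ((0 : Fin 2), (3 : ℤ)) ∉ F :=
    fun F => notMem_of_mem_regionFaces fun c hc => by grind [staircase]
  obtain ⟨K, X, h⟩ := h _ hw
  exact ⟨K, X, _, _, _, h⟩

theorem mem_regionFaces_rectangle_iff {F : Finset (Fin 2 × ℤ)} :
    F ∈ regionFaces (staircase x₀ y₀ t y₀) ↔
      ∃ x ∈ Finset.Icc x₀ 0, ∃ y ∈ Finset.Ico y₀ t, F ⊆ gridCell ![x, y] := by
  simp only [Finset.mem_Icc, Finset.mem_Ico]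
  constructor
  · rintro ⟨c, ⟨hx, hy, hc⟩, hF⟩
    have hcell : c = ![c 0, c 1] := funext (Fin.forall_fin_two.2 ⟨rfl, rfl⟩)
    exact ⟨c 0, by omega, c 1, by omega, hcell ▸ hF⟩
  · rintro ⟨x, hx, y, hy, hF⟩
    exact ⟨_, vec_mem_staircase.2 (by omega), hF⟩

/-- The vertices of the two cells of `staircase 0 0 2 0`. -/
def twoCellVertices : Finset (Fin 2 × ℤ) := {(0, 0), (0, 1), (1, 0), (1, 1), (1, 2)}

theorem mem_regionFaces_two_cells_iff {F : Finset (Fin 2 × ℤ)} :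
    F ∈ regionFaces (staircase 0 0 2 0) ↔
      F ⊆ twoCellVertices.erase (1, 0) ∨ F ⊆ twoCellVertices.erase (1, 2) := by
  have hupper : gridCell ![0, 1] = twoCellVertices.erase (1, 0) := by decide
  have hlower : gridCell ![0, 0] = twoCellVertices.erase (1, 2) := by decide
  have hcells : Finset.Ico (0 : ℤ) 2 = {0, 1} := by decide
  simp only [mem_regionFaces_rectangle_iff, Finset.Icc_self, hcells, Finset.mem_singleton,
    exists_eq_left, Finset.mem_insert, exists_eq_or_imp, hupper, hlower]
  exact or_comm

theorem mem_of_mem_regionInterior_two_cells {F : Finset (Fin 2 × ℤ)}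
    (hF : F ∈ regionInterior (staircase 0 0 2 0)) : (0, 0) ∈ F ∧ (0, 1) ∈ F ∧ (1, 1) ∈ F := by
  have hFY : ∀ v ∈ F, v ∈ twoCellVertices := fun v hv =>
    (mem_regionFaces_two_cells_iff.1 (regionInterior_subset _ hF)).elim
      (fun h => Finset.mem_of_mem_erase (h hv)) fun h => Finset.mem_of_mem_erase (h hv)
  have hline₀ : ∀ x, (0, x) ∈ F → x = 0 ∨ x = 1 := fun x hx => by
    simpa [twoCellVertices] using hFY _ hx
  have hline₁ : ∀ y, (1, y) ∈ F → y = 0 ∨ y = 1 ∨ y = 2 := fun y hy => by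
    simpa [twoCellVertices] using hFY _ hy
  refine ⟨?_, ?_, ?_⟩
  · obtain ⟨x, hx, hx₁, hx₂⟩ := exists_mem_of_mem_regionInterior (a := 0) (r := 1)
      (by grind [staircase]) hF
    obtain rfl : x = 0 := by grind
    exact hx
  · obtain ⟨x, hx, hx₁, hx₂⟩ := exists_mem_of_mem_regionInterior (a := 0) (r := -1)
      (by grind [staircase]) hF
    obtain rfl : x = 1 := by grind
    exact hx
  · obtain ⟨y, hy, -, hy₂⟩ := exists_mem_of_mem_regionInterior (a := 1) (r := -1)
      (by grind [staircase]) hF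
    obtain ⟨y', hy', hy'₁, -⟩ := exists_mem_of_mem_regionInterior (a := 1) (r := 2)
      (by grind [staircase]) hF
    have hpair : (1, 0) ∉ F ∨ (1, 2) ∉ F :=
      (mem_regionFaces_two_cells_iff.1 (regionInterior_subset _ hF)).imp
        (fun h hv => Finset.notMem_erase _ _ (h hv)) fun h hv => Finset.notMem_erase _ _ (h hv)
    grind

theorem hasStaircaseSphere_six : HasStaircaseSphere 0 0 2 0 6 0 := by
  intro w hw
  set Y := twoCellVertices
  have hspan : ∀ v ∈ Y, {v} ∈ regionFaces (staircase 0 0 2 0) := by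
    simp only [mem_regionFaces_two_cells_iff, Finset.singleton_subset_iff]
    decide
  have hwY : w ∉ Y := fun hwY => hw _ (hspan w hwY) (Finset.mem_singleton_self w)
  have hcard : (insert w Y).card = 6 := Finset.card_insert_of_notMem hwY
  have hmissing : missingFaces (Iio (insert w Y)) 4 = ∅ :=
    missingFaces_Iio (by norm_num) (by omega)
  refine ⟨Iio (insert w Y), insert w Y, isLowerSet_Iio _, fun F hF => hF.subset, hcard,
    Finset.mem_insert_self w Y, fun F hFX hF => hFX.ssubset_of_ne fun h => ?_,
    isPLSphereFamily_Iio hcard, by rw [hmissing, ncard_empty], by simp [hmissing], hw,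
    fun F hF => ?_, fun F hF G hG hFG => ?_,
    fun v hv hvw => hspan v (Finset.mem_of_mem_insert_of_ne hv hvw)⟩
  · rw [h, hcard] at hF
    omega
  · have hF := mem_regionFaces_two_cells_iff.1 hF
    have hFY : F ⊆ Y :=
      hF.elim (·.trans (Finset.erase_subset ..)) (·.trans (Finset.erase_subset ..))
    have hF4 : F.card ≤ 4 := hF.elim Finset.card_le_card Finset.card_le_card
    refine (Finset.insert_subset_insert w hFY).ssubset_of_ne fun h => ?_
    have := Finset.card_insert_le w F
    rw [h, hcard] at this
    omega
  · obtain ⟨u, hu, huG⟩ := Finset.exists_of_ssubset hG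
    obtain ⟨h₁, h₂, h₃⟩ := mem_of_mem_regionInterior_two_cells hF
    have hGY : G.erase w ⊆ Y.erase u := fun v hv => by grind
    obtain rfl | rfl : u = (1, 0) ∨ u = (1, 2) := by grind [twoCellVertices]
    exacts [mem_regionFaces_two_cells_iff.2 (.inl hGY), mem_regionFaces_two_cells_iff.2 (.inr hGY)]

theorem choose_two_succ (k : ℕ) : (k + 1).choose 2 = k.choose 2 + k := by
  rw [Nat.choose_succ_succ' k, Nat.choose_one_right, add_comm]

theorem hasStaircaseSphere_stacked (k : ℕ) :
    HasStaircaseSphere 0 0 (k + 2) 0 (k + 6) ((k + 1).choose 2) := by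
  induction k with
  | zero => exact hasStaircaseSphere_six
  | succ k ih =>
    convert ih.extend_of_zero (by omega) (by omega) (.inl rfl)
      (isExtension_staircase_top le_rfl (by omega) (by omega)) using 1
    · push_cast
      ring
    · rw [choose_two_succ (k + 1)]
      congr 1
      omega

theorem hasStaircaseSphere_stacked_right (k : ℕ) (hs : 2 ≤ s) (hsk : s ≤ k + 2) :
    HasStaircaseSphere 0 0 (k + 2) s (k + 7) ((k + 2).choose 2) := by
  convert (hasStaircaseSphere_stacked k).extend_of_zero (by omega) (by omega) (.inl rfl)
    (isExtension_staircase_right (s := s) le_rfl (by omega) hsk) using 1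
  rw [choose_two_succ (k + 1)]
  congr 1
  omega

theorem existsConeSphere_choose_add (k d j : ℕ) (hd : d ≤ k) :
    ExistsConeSphere (k + 8 + j) ((k + 2).choose 2 + d) := by
  have h := (hasStaircaseSphere_stacked_right k (s := k + 2 - d) (by omega)
    (by omega)).extend_of_zero (by omega) (by omega) (by omega)
      (isExtension_staircase_left le_rfl (by omega))
  have hd : (k + 2 - max (k + 2 - d : ℤ) (0 + 1)).toNat = d := by omega
  rw [hd] at h
  exact (h.extend_left_iterate (by omega) (by omega) (by omega) (by omega) j).existsConeSphere

theorem existsConeSphere_choose_sub_one (k j : ℕ) :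
    ExistsConeSphere (k + 9 + j) ((k + 3).choose 2 - 1) := by
  have hchoose : (k + 3).choose 2 = (k + 2).choose 2 + (k + 2) := choose_two_succ (k + 2)
  obtain ⟨i, hi⟩ := Nat.even_or_odd' (k + 1)
  have hright := hasStaircaseSphere_stacked_right k (s := k + 2 - i) (by omega) (by omega)
  obtain ⟨x₀, y₀, t, s, hx₀, ht, hst, hs, h⟩ : ∃ x₀ y₀ t s, x₀ < 0 ∧ y₀ + 2 ≤ t ∧ s ≤ t ∧
      y₀ + 2 ≤ s ∧ HasStaircaseSphere x₀ y₀ t s (k + 9) ((k + 3).choose 2 - 1) := by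
    rcases hi with hi | hi
    · have h := (hright.extend_of_zero (by omega) (by omega) (by omega)
        (isExtension_staircase_bottom le_rfl (by omega) (by omega))).extend_of_zero
          (by omega) (by omega) (by omega) (isExtension_staircase_left le_rfl (by omega))
      refine ⟨0 - 1, 0 - 1, k + 2, k + 2 - i, by omega, by omega, by omega, by omega, ?_⟩
      convert h using 1
      omega
    · have h := (hright.extend_of_zero (by omega) (by omega) (by omega)
        (isExtension_staircase_top le_rfl (by omega) (by omega))).extend_of_zero
          (by omega) (by omega) (by omega) (isExtension_staircase_left le_rfl (by omega))
      refine ⟨0 - 1, 0, k + 2 + 1, k + 2 - i, by omega, by omega, by omega, by omega, ?_⟩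
      convert h using 1
      omega
  exact (h.extend_left_iterate hx₀ ht hst (.inr hs) j).existsConeSphere

end StaircaseSpheres

section Facets

variable {V : Type*}

/-- The simplicial complex with facets `L`, as a family that contains the empty set. -/
def complexOfFacets (L : Finset (Finset V)) : Set (Finset V) := {F | ∃ G ∈ L, F ⊆ G}

theorem isLowerSet_complexOfFacets (L : Finset (Finset V)) : IsLowerSet (complexOfFacets L) :=
  fun _ _ hGF ⟨H, hH, hFH⟩ => ⟨H, hH, hGF.trans hFH⟩

variable [DecidableEq V] {L : Finset (Finset V)} {σ τ F : Finset V} {d : ℕ}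

theorem complexOfFacets_image_erase (S : Finset V) :
    complexOfFacets (S.image S.erase) = Iio S := by
  ext F
  simp only [complexOfFacets, mem_ofPred_eq, Finset.mem_image, exists_exists_and_eq_and, mem_Iio]
  exact Finset.ssubset_iff_exists_subset_erase.symm

/-- The facets of the bistellar flip along `σ` and `τ` of a complex with facets `L`. -/
def flipFacets (L : Finset (Finset V)) (σ τ : Finset V) : Finset (Finset V) :=
  {G ∈ L | ¬ σ ⊆ G} ∪ σ.image (σ ∪ τ).erase

/-- The conditions for a bistellar flip in terms of facets, which makes them decidable. -/
def CanFlip (L : Finset (Finset V)) (σ τ : Finset V) : Prop :=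
  2 ≤ σ.card ∧ τ.Nonempty ∧ Disjoint σ τ ∧ (∀ G ∈ L, σ ⊆ G → G ⊆ σ ∪ τ) ∧
    (∀ v ∈ τ, ∃ G ∈ L, (σ ∪ τ).erase v ⊆ G) ∧ ∀ G ∈ L, ¬ τ ⊆ G

instance (L : Finset (Finset V)) (σ τ : Finset V) : Decidable (CanFlip L σ τ) :=
  inferInstanceAs (Decidable (_ ∧ _))

/-- The flips of a list can be performed one after the other. -/
def CanFlipAll : Finset (Finset V) → List (Finset V × Finset V) → Prop
  | _, [] => True
  | L, p :: ps => CanFlip L p.1 p.2 ∧ CanFlipAll (flipFacets L p.1 p.2) ps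

instance decidableCanFlipAll : (L : Finset (Finset V)) → (ps : List (Finset V × Finset V)) →
    Decidable (CanFlipAll L ps)
  | _, [] => .isTrue trivial
  | L, p :: ps =>
    have := decidableCanFlipAll (flipFacets L p.1 p.2) ps
    inferInstanceAs (Decidable (_ ∧ _))

theorem CanFlip.isFlippable (h : CanFlip L σ τ) : IsFlippable (complexOfFacets L) σ τ where
  lower := isLowerSet_complexOfFacets L
  disjoint := h.2.2.1
  left_nonempty := Finset.card_pos.1 (by have := h.1; omega)
  right_nonempty := h.2.1
  star := fun _ ⟨G, hG, hFG⟩ hσF => hFG.trans (h.2.2.2.1 G hG (hσF.trans hFG))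
  mem := fun F hF hτF => by
    obtain ⟨v, hv, hvF⟩ := Finset.not_subset.1 hτF
    obtain ⟨G, hG, hvG⟩ := h.2.2.2.2.1 v hv
    exact ⟨G, hG, (Finset.subset_erase.2 ⟨hF, hvF⟩).trans hvG⟩
  notMem := fun ⟨G, hG, hτG⟩ => h.2.2.2.2.2 G hG hτG

theorem mem_complexOfFacets_flipFacets : F ∈ complexOfFacets (flipFacets L σ τ) ↔
    (∃ G ∈ L, ¬ σ ⊆ G ∧ F ⊆ G) ∨ F ⊆ σ ∪ τ ∧ ¬ σ ⊆ F := by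
  have hnew : F ⊆ σ ∪ τ ∧ ¬ σ ⊆ F ↔ ∃ v ∈ σ, F ⊆ (σ ∪ τ).erase v := by
    simp only [Finset.subset_erase, Finset.not_subset]
    tauto
  simp only [complexOfFacets, flipFacets, Finset.mem_union, Finset.mem_filter, Finset.mem_image,
    mem_ofPred_eq, hnew, or_and_right, exists_or, exists_exists_and_eq_and, and_assoc]

theorem CanFlip.complexOfFacets_flipFacets (h : CanFlip L σ τ) :
    complexOfFacets (flipFacets L σ τ) = bistellarFlip (complexOfFacets L) σ τ := by
  ext F
  rw [mem_complexOfFacets_flipFacets, mem_bistellarFlip]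
  constructor
  · rintro (⟨G, hG, hσG, hFG⟩ | ⟨hF, hσF⟩)
    · exact ⟨.inl ⟨G, hG, hFG⟩, fun hσF => hσG (hσF.trans hFG)⟩
    · exact ⟨or_iff_not_imp_right.2 fun hτF => h.isFlippable.mem F hF fun hτ => hτF ⟨hτ, hF⟩, hσF⟩
  · rintro ⟨⟨G, hG, hFG⟩ | ⟨-, hF⟩, hσF⟩
    · by_cases hσG : σ ⊆ G
      · exact .inr ⟨hFG.trans (h.2.2.2.1 G hG hσG), hσF⟩
      · exact .inl ⟨G, hG, hσG, hFG⟩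
    · exact .inr ⟨hF, hσF⟩

theorem IsPLSphereFamily.foldl_flipFacets {ps : List (Finset V × Finset V)}
    (hL : IsPLSphereFamily (complexOfFacets L) d) (hps : CanFlipAll L ps) :
    IsPLSphereFamily (complexOfFacets (ps.foldl (fun L p => flipFacets L p.1 p.2) L)) d := by
  induction ps generalizing L with
  | nil => exact hL
  | cons p ps ih =>
    refine ih ?_ hps.2
    rw [hps.1.complexOfFacets_flipFacets]
    exact hL.flip hps.1.isFlippable hps.1.1

end Facets

section NineVertices

/-- Bistellar flips which lead from the boundary of a `5`-simplex to a `2`-neighborly sphere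
without missing tetrahedra. -/
def nineVertexFlips : List (Finset (Fin 2 × ℤ) × Finset (Fin 2 × ℤ)) :=
  [({(1, 0), (1, 1), (1, 2), (0, 1), (0, 0)}, {(1, 3)}),
   ({(1, 0), (1, 2), (0, 1), (0, 0)}, {(0, -1), (1, 3)}),
   ({(1, 0), (1, 2), (0, -1), (1, 3), (0, 0)}, {(1, 4)}),
   ({(1, 0), (1, 2), (1, 3), (0, 0)}, {(1, 1), (1, 4)}),
   ({(1, 0), (1, 2), (0, 0)}, {(1, 1), (0, -1), (1, 4)}),
   ({(1, 0), (1, 1), (1, 3), (0, 0)}, {(0, 1), (1, 4)}),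
   ({(1, 0), (0, -1), (1, 3), (0, 1), (0, 0)}, {(0, -2)}),
   ({(1, 0), (0, -1), (1, 3), (0, 0)}, {(0, -2), (1, 4)}),
   ({(1, 0), (1, 3), (0, 0)}, {(0, -2), (0, 1), (1, 4)}),
   ({(0, -1), (1, 3), (0, 1), (0, 0)}, {(0, -2), (1, 2)}),
   ({(1, 2), (0, -1), (0, 1), (0, 0)}, {(0, -2), (1, 1)}),
   ({(0, -1), (0, 1), (0, 0)}, {(0, -2), (1, 0), (1, 1)})]

/-- The vertices of the simplex with which `nineVertexFlips` starts. -/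
def sixVertices : Finset (Fin 2 × ℤ) := {(1, 0), (1, 1), (1, 2), (0, -1), (0, 1), (0, 0)}

/-- The facets of a `2`-neighborly sphere with nine vertices and without missing tetrahedra. -/
def nineVertexFacets : Finset (Finset (Fin 2 × ℤ)) :=
  nineVertexFlips.foldl (fun L p => flipFacets L p.1 p.2) (sixVertices.image sixVertices.erase)

/-- The vertices of the complex with facets `nineVertexFacets`. -/
def nineVertices : Finset (Fin 2 × ℤ) :=
  {(0, -2), (0, -1), (0, 0), (0, 1), (1, 0), (1, 1), (1, 2), (1, 3), (1, 4)}

theorem isPLSphereFamily_nineVertexFacets :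
    IsPLSphereFamily (complexOfFacets nineVertexFacets) 4 := by
  refine IsPLSphereFamily.foldl_flipFacets ?_ (by decide +kernel : CanFlipAll _ nineVertexFlips)
  rw [complexOfFacets_image_erase]
  exact isPLSphereFamily_Iio rfl

theorem subset_nineVertices : ∀ F ∈ complexOfFacets nineVertexFacets, F ⊆ nineVertices :=
  fun _ ⟨G, hG, hFG⟩ =>
  hFG.trans ((by decide +kernel : ∀ G ∈ nineVertexFacets, G ⊆ nineVertices) G hG)

theorem mem_nineVertexFacets_of_card_eq_two :
    ∀ F ⊆ nineVertices, F.card = 2 → F ∈ complexOfFacets nineVertexFacets := fun F hF hcard =>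
  (by decide +kernel : ∀ F ∈ nineVertices.powersetCard 2, ∃ G ∈ nineVertexFacets, F ⊆ G) F
    (Finset.mem_powersetCard.2 ⟨hF, hcard⟩)

theorem missingFaces_nineVertexFacets : missingFaces (complexOfFacets nineVertexFacets) 4 = ∅ := by
  have hcheck : ∀ F ∈ nineVertices.powersetCard 4, (∃ G ∈ nineVertexFacets, F ⊆ G) ∨
      ∃ v ∈ F, ∀ G ∈ nineVertexFacets, ¬ F.erase v ⊆ G := by
    decide +kernel
  refine eq_empty_of_forall_notMem fun F hF => ?_
  have hFX := subset_of_mem_missingFaces subset_nineVertices (by norm_num) hF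
  rcases hcheck F (Finset.mem_powersetCard.2 ⟨hFX, hF.2⟩) with hFK | ⟨v, hv, hvF⟩
  · exact hF.1.prop hFK
  · obtain ⟨G, hG, hvG⟩ := not_not.1 (hF.1.not_prop_of_lt (Finset.erase_ssubset hv))
    exact hvF G hG hvG

theorem insert_mem_complexOfFacets_nineVertexFacets {F : Finset (Fin 2 × ℤ)}
    (hF : F ∈ regionFaces (staircase (-1) 0 4 0)) :
    insert (0, -2) F ∈ complexOfFacets nineVertexFacets := by
  have hcells : ∀ x ∈ Finset.Icc (-1) 0, ∀ y ∈ Finset.Ico 0 4, ∃ G ∈ nineVertexFacets,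
      insert (0, -2) (gridCell ![x, y]) ⊆ G := by
    decide +kernel
  obtain ⟨x, hx, y, hy, hF⟩ := mem_regionFaces_rectangle_iff.1 hF
  obtain ⟨G, hG, hxyG⟩ := hcells x hx y hy
  exact ⟨G, hG, (Finset.insert_subset_insert _ hF).trans hxyG⟩

theorem mem_of_mem_regionInterior_nineVertices {F : Finset (Fin 2 × ℤ)}
    (hF : F ∈ regionInterior (staircase (-1) 0 4 0)) :
    (0, 0) ∈ F ∧ ∃ y ∈ Finset.Icc (1 : ℤ) 3, (1, y) ∈ F := by
  obtain ⟨c, ⟨hx₀, hy₀, hc⟩, hFc⟩ := regionInterior_subset _ hF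
  have hFc : ∀ a x, (a, x) ∈ F → x = c a ∨ x = c a + 1 := fun a x hx => mem_gridCell.1 (hFc hx)
  obtain ⟨x, hx, -, hx₁⟩ := exists_mem_of_mem_regionInterior (a := 0) (r := -2)
    (by grind [staircase]) hF
  obtain ⟨x', hx', hx'₁, -⟩ := exists_mem_of_mem_regionInterior (a := 0) (r := 1)
    (by grind [staircase]) hF
  obtain ⟨y, hy, -, hy₁⟩ := exists_mem_of_mem_regionInterior (a := 1) (r := -1)
    (by grind [staircase]) hF
  obtain ⟨y', hy', hy'₁, -⟩ := exists_mem_of_mem_regionInterior (a := 1) (r := 4)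
    (by grind [staircase]) hF
  simp only [Finset.mem_Icc]
  grind [hFc 0 x hx, hFc 0 x' hx', hFc 1 y hy, hFc 1 y' hy']

theorem isConeSphere_nineVertices :
    IsConeSphere (complexOfFacets nineVertexFacets) nineVertices (0, -2)
      (regionFaces (staircase (-1) 0 4 0)) (regionInterior (staircase (-1) 0 4 0)) 9 0 where
  lower := isLowerSet_complexOfFacets _
  subset := subset_nineVertices
  card := rfl
  apex_mem := by decide
  edge := mem_nineVertexFacets_of_card_eq_two
  sphere := isPLSphereFamily_nineVertexFacets
  missing := by rw [missingFaces_nineVertexFacets, ncard_empty]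
  apex_notMem := by simp [missingFaces_nineVertexFacets]
  ball_notMem F := notMem_of_mem_regionFaces fun c hc => by grind [staircase]
  insert_mem _ := insert_mem_complexOfFacets_nineVertexFacets
  star F hF G := fun ⟨H, hH, hGH⟩ hFG => by
    have hcheck : ∀ G ∈ nineVertexFacets, (0, -2) ∈ G → (0, 0) ∈ G →
        (∃ y ∈ Finset.Icc (1 : ℤ) 3, (1, y) ∈ G) → ∃ x ∈ Finset.Icc (-1) 0,
          ∃ y ∈ Finset.Ico 0 4, G.erase (0, -2) ⊆ gridCell ![x, y] := by
      decide +kernel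
    obtain ⟨hwH, hFH⟩ := Finset.insert_subset_iff.1 (hFG.trans hGH)
    obtain ⟨h₀, y, hy, h₁⟩ := mem_of_mem_regionInterior_nineVertices hF
    obtain ⟨x, hx, y, hy, h⟩ := hcheck H hH hwH (hFH h₀) ⟨y, hy, hFH h₁⟩
    exact mem_regionFaces_rectangle_iff.2
      ⟨x, hx, y, hy, (Finset.erase_subset_erase _ hGH).trans h⟩
  spanning v hv hvw := mem_regionFaces_rectangle_iff.2 <|
    (by decide +kernel : ∀ v ∈ nineVertices, v ≠ (0, -2) → ∃ x ∈ Finset.Icc (-1) 0,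
      ∃ y ∈ Finset.Ico 0 4, {v} ⊆ gridCell ![x, y]) v hv hvw

end NineVertices

section Existence

variable {n m : ℕ}

theorem hasStaircaseSphere_ten : HasStaircaseSphere (-2) 0 4 0 10 0 := by
  have h := isConeSphere_nineVertices.hasConeSphere_of_isExtension rfl
    (isIdealAbove_staircase (by norm_num)) (finite_staircase ..)
    (isExtension_staircase_left (by norm_num) (by norm_num))
  rwa [ncard_minimalFaces_staircase_of_neg (by norm_num) (by norm_num) (by norm_num) (.inl rfl)]
    at h

theorem existsConeSphere_zero (hn : 9 ≤ n) : ExistsConeSphere n 0 := by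
  obtain rfl | hn := hn.eq_or_lt
  · exact ⟨_, _, _, _, _, isConeSphere_nineVertices⟩
  · obtain ⟨j, rfl⟩ := Nat.exists_eq_add_of_le hn
    exact (hasStaircaseSphere_ten.extend_left_iterate (by norm_num) (by norm_num) (by norm_num)
      (.inl rfl) j).existsConeSphere

theorem exists_eq_choose_two_add (hm : 0 < m) :
    ∃ k d : ℕ, d ≤ k + 1 ∧ m = (k + 2).choose 2 + d := by
  induction m, hm using Nat.le_induction with
  | base => exact ⟨0, 0, by omega, rfl⟩
  | succ m _ ih =>
    obtain ⟨k, d, hd, rfl⟩ := ih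
    rcases hd.eq_or_lt with rfl | hd
    · exact ⟨k + 1, 0, by omega, (choose_two_succ (k + 2)).symm⟩
    · exact ⟨k, d + 1, by omega, rfl⟩

theorem existsConeSphere_of_pos (hn : 9 ≤ n) (hm₀ : 0 < m) (hm : m ≤ (n - 5).choose 2)
    (hm' : m ≠ (n - 5).choose 2 - 1) : ExistsConeSphere n m := by
  rcases hm.eq_or_lt with rfl | hlt
  · obtain ⟨k, rfl⟩ := Nat.exists_eq_add_of_le' (show 6 ≤ n by omega)
    exact (hasStaircaseSphere_stacked k).existsConeSphere
  obtain ⟨k, d, hd, rfl⟩ := exists_eq_choose_two_add hm₀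
  have hchoose : (k + 3).choose 2 = (k + 2).choose 2 + (k + 2) := choose_two_succ (k + 2)
  have hkn : k + 8 ≤ n := by
    by_contra! hkn
    have := Nat.choose_le_choose 2 (show n - 5 ≤ k + 2 by omega)
    omega
  obtain ⟨j, rfl⟩ := Nat.exists_eq_add_of_le hkn
  rcases Nat.lt_or_ge k d with hkd | hdk
  · obtain rfl : d = k + 1 := by omega
    obtain _ | j := j
    · exact absurd (show _ = (k + 3).choose 2 - 1 by omega) hm'
    · convert existsConeSphere_choose_sub_one k j using 1 <;> omega
  · exact existsConeSphere_choose_add k d j hdk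

theorem ExistsConeSphere.exists_complex (h : ExistsConeSphere n m) (hn : 2 ≤ n) :
    ∃ Δ : AbstractSimplicialComplex (Fin n),
      Δ.IsPLSphere 4 ∧ Δ.IsNeighborly 2 ∧ Δ.missingFaceCount 3 = m := by
  obtain ⟨K, X, w, B, I, h⟩ := h
  exact h.missing ▸ exists_complex_of_isPLSphereFamily h.card h.lower h.subset (by norm_num) hn
    h.edge h.sphere (by norm_num)

end Existence

/-- An `AbstractSimplicialComplex (Fin n)` contains every singleton of `Fin n`, so it has exactly
`n` vertices. -/
theorem mainTheorem3 (n : ℕ) (hn : 9 ≤ n) (m : ℕ) (hm : m ≤ (n - 5).choose 2)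
    (hm' : m ≠ (n - 5).choose 2 - 1) :
    ∃ Δ : AbstractSimplicialComplex (Fin n),
      Δ.IsPLSphere 4 ∧ Δ.IsNeighborly 2 ∧ Δ.missingFaceCount 3 = m := by
  have h : ExistsConeSphere n m := by
    rcases Nat.eq_zero_or_pos m with rfl | hm₀
    · exact existsConeSphere_zero hn
    · exact existsConeSphere_of_pos hn hm₀ hm hm'
  exact h.exists_complex (by omega)
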